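/- Let $z \ge 2$ be real and let $W_0 \ge 1$ be an integer. A local obstruction pattern $\Omega$ up to $z$ assigns to each prime $p \le z$ with $p \nmid W_0$ a set $\Omega(p) \subseteq (\mathbb{Z}/p\mathbb{Z})^\times$; put $\omega(p) = |\Omega(p)|$, and for squarefree $d$ coprime to $W_0$ with all prime factors $\le z$ put $\omega(d) = \prod_{p \mid d} \omega(p)$ and $g(d) = \omega(d)/\varphi(d)$. Define $$\mathrm{Weak}_{\mathrm{loc}}(\Omega; z) = \prod_{p \le z,\ p \nmid W_0} \Bigl(1 - \frac{\omega(p)}{p-1}\Bigr), \qquad \mathrm{Weak}_{\mathrm{Sel}}(\Omega; z, R) = \inf_{\lambda_1 = 1}\ \sum_{d_1} \sum_{d_2} \lambda_{d_1} \lambda_{d_2}\, g([d_1, d_2]),$$ where the infimum is over real coefficients $\lambda = (\lambda_d)$ with $\lambda_1 = 1$, supported on the squarefree $d \le R$ that are coprime to $W_0$ and have all their prime factors $\le z$. For real $\kappa \ge 0$ let $\sigma_\kappa$ be the Selberg (Ankeny--Onishi) sieve function: $\sigma_\kappa(u) = 0$ for $u \le 0$, $\sigma_\kappa(u) = \frac{e^{-\gamma\kappa}}{\Gamma(\kappa+1)}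 (u/2)^\kappa$ for $0 < u \le 2$, and, continuously for $u > 2$, $\bigl(u^{-\kappa} \sigma_\kappa(u)\bigr)' = -\kappa\, u^{-\kappa-1} \sigma_\kappa(u-2)$, where $\gamma$ is Euler's constant. Let $F_\kappa(s) = 1/\sigma_\kappa(2s)$ be the upper-bound sieve function of dimension $\kappa$ of Selberg's sieve, where $s$ is measured with respect to the support bound $R$ of the coefficients $\lambda_d$ (so the level of the sieve is $R^2$). Proposition. Let $\kappa \ge 0$ and $s > 1$. There is a function $\eta = \eta_{s,\kappa}$, depending only on $s$ and $\kappa$, with $\eta(z) \to 0$ as $z \to \infty$, such that for all $z \ge 2$, all $R > 0$ with $\log R/\log z = s$, all $W_0 \ge 1$, and all patterns $\Omega$ with $\omega(p) \le \kappa$ for every prime $p \le z$, $p \nmid W_0$, $$\mathrm{Weak}_{\mathrm{Sel}}(\Omega; z, R) \le \bigl(F_\kappa(s) + \eta(z)\bigr)\, \mathrm{Weak}_{\mathrm{loc}}(\Omega; z).$$ -/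

import Mathlib

open Filter Topology

noncomputable section

/-- A local obstruction pattern: for each prime `p` a set `Ω p` of forbidden reduced residue
classes modulo `p`. For a sieve cutoff `z` and a wheel modulus `W₀`, only the values at the primes
`p ≤ z` with `p ∤ W₀` are ever used. -/
abbrev ObstructionPattern : Type := (p : ℕ) → Finset (ZMod p)ˣ

/-- The primes `p ≤ z` with `p ∤ W₀`. -/
def sievePrimes (W₀ : ℕ) (z : ℝ) : Finset ℕ :=
  (Finset.Icc 1 ⌊z⌋₊).filter fun p => p.Prime ∧ ¬ p ∣ W₀

/-- The squarefree `d ≤ R` coprime to `W₀`, all of whose prime factors are `≤ z`. -/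
def selbergSupport (W₀ : ℕ) (z R : ℝ) : Finset ℕ :=
  (Finset.Icc 1 ⌊R⌋₊).filter fun d =>
    Squarefree d ∧ (∀ p ∈ d.primeFactors, (p : ℝ) ≤ z) ∧ d.Coprime W₀

namespace ObstructionPattern

/-- `ω(d) = ∏_{p ∣ d} |Ω(p)|`. -/
def omega (Ω : ObstructionPattern) (d : ℕ) : ℕ := ∏ p ∈ d.primeFactors, (Ω p).card

/-- `g(d) = ω(d) / φ(d)`. -/
def density (Ω : ObstructionPattern) (d : ℕ) : ℝ := (Ω.omega d : ℝ) / (Nat.totient d : ℝ)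

/-- Local weakness `∏_{p ≤ z, p ∤ W₀} (1 - ω(p)/(p-1))`. -/
def weakLoc (Ω : ObstructionPattern) (W₀ : ℕ) (z : ℝ) : ℝ :=
  ∏ p ∈ sievePrimes W₀ z, (1 - (Ω.omega p : ℝ) / ((p : ℝ) - 1))

/-- The Selberg quadratic form `∑_{d₁} ∑_{d₂} λ_{d₁} λ_{d₂} g([d₁, d₂])`. -/
def selbergForm (Ω : ObstructionPattern) (W₀ : ℕ) (z R : ℝ) (lam : ℕ → ℝ) : ℝ :=
  ∑ d₁ ∈ selbergSupport W₀ z R, ∑ d₂ ∈ selbergSupport W₀ z R,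
    lam d₁ * lam d₂ * Ω.density (Nat.lcm d₁ d₂)

/-- The values of the Selberg form at the coefficients `λ` supported on `selbergSupport W₀ z R`
with `λ_1 = 1`. -/
def selbergValues (Ω : ObstructionPattern) (W₀ : ℕ) (z R : ℝ) : Set ℝ :=
  {J | ∃ lam : ℕ → ℝ, lam 1 = 1 ∧ (∀ d, d ∉ selbergSupport W₀ z R → lam d = 0) ∧
    J = Ω.selbergForm W₀ z R lam}

/-- Selberg weakness: the infimum of the Selberg form subject to `λ_1 = 1`. -/
def weakSel (Ω : ObstructionPattern) (W₀ : ℕ) (z R : ℝ) : ℝ := sInf (Ω.selbergValues W₀ z R)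

/-- The infimum is over a nonempty set as soon as `R ≥ 1`. -/
theorem selbergValues_nonempty (Ω : ObstructionPattern) (W₀ : ℕ) (z R : ℝ) (hR : 1 ≤ R) :
    (Ω.selbergValues W₀ z R).Nonempty := by
  refine ⟨_, fun d => if d = 1 then 1 else 0, by simp, ?_, rfl⟩
  intro d hd
  refine if_neg ?_
  rintro rfl
  apply hd
  simp [selbergSupport, Nat.one_le_floor_iff, hR]

theorem density_eq (Ω : ObstructionPattern) {d : ℕ} (hd : Squarefree d) :
    Ω.density d = ∏ p ∈ d.primeFactors, ((Ω p).card : ℝ) / ((p : ℝ) - 1) := by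
  have h1 := Nat.totient_mul_prod_primeFactors d
  rw [Nat.prod_primeFactors_of_squarefree hd, mul_comm] at h1
  have h2 : Nat.totient d = ∏ p ∈ d.primeFactors, (p - 1) :=
    Nat.eq_of_mul_eq_mul_left (Nat.pos_of_ne_zero hd.ne_zero) h1
  rw [density, h2, omega, Finset.prod_div_distrib]
  push_cast
  congr 1
  refine Finset.prod_congr rfl fun p hp => ?_
  rw [Nat.cast_sub (Nat.prime_of_mem_primeFactors hp).one_le, Nat.cast_one]

/-- The Selberg form is nonnegative. -/
theorem selbergForm_nonneg (Ω : ObstructionPattern) (W₀ : ℕ) (z R : ℝ) (lam : ℕ → ℝ) :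
    0 ≤ Ω.selbergForm W₀ z R lam := by
  classical
  set S := selbergSupport W₀ z R with hS
  set P := S.biUnion Nat.primeFactors with hP
  set a : ℕ → ℝ := fun p => ((Ω p).card : ℝ) / ((p : ℝ) - 1) with ha
  set w : Finset ℕ → ℝ := fun T => (∏ p ∈ T, a p) * ∏ p ∈ P \ T, (1 - a p) with hw
  have hPp : ∀ p ∈ P, p.Prime := by
    intro p hp
    obtain ⟨d, -, hd⟩ := Finset.mem_biUnion.1 hp
    exact Nat.prime_of_mem_primeFactors hd
  have ha0 : ∀ p ∈ P, 0 ≤ a p := by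
    intro p hp
    have h1 : (1 : ℝ) ≤ p := by exact_mod_cast (hPp p hp).one_le
    exact div_nonneg (Nat.cast_nonneg _) (by linarith)
  have ha1 : ∀ p ∈ P, a p ≤ 1 := by
    intro p hp
    have hpp := hPp p hp
    have : Fact p.Prime := ⟨hpp⟩
    have h1 : (1 : ℝ) < p := by exact_mod_cast hpp.one_lt
    have h2 : (Ω p).card ≤ p - 1 := by
      have := Finset.card_le_univ (Ω p)
      rwa [ZMod.card_units_eq_totient, Nat.totient_prime hpp] at this
    have h3 : ((Ω p).card : ℝ) ≤ (p : ℝ) - 1 := by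
      have : ((Ω p).card : ℝ) ≤ ((p - 1 : ℕ) : ℝ) := by exact_mod_cast h2
      rwa [Nat.cast_sub hpp.one_le, Nat.cast_one] at this
    rw [ha]
    exact (div_le_one (by linarith)).2 h3
  have hexp : ∀ A ⊆ P, ∏ p ∈ A, a p = ∑ T ∈ P.powerset, w T * (if A ⊆ T then 1 else 0) := by
    intro A hA
    have h1 : ∏ p ∈ A, a p = ∏ p ∈ P, (a p + (if p ∈ A then 0 else 1 - a p)) := by
      rw [← Finset.prod_subset hA]
      · exact Finset.prod_congr rfl fun p hp => by simp [hp]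
      · intro p _ hp
        simp [hp]
    rw [h1, Finset.prod_add]
    refine Finset.sum_congr rfl fun T hT => ?_
    rw [hw, mul_assoc]
    congr 1
    by_cases hAT : A ⊆ T
    · rw [if_pos hAT, mul_one]
      refine Finset.prod_congr rfl fun p hp => ?_
      rw [if_neg]
      exact fun h => (Finset.mem_sdiff.1 hp).2 (hAT h)
    · rw [if_neg hAT, mul_zero]
      obtain ⟨p, hpA, hpT⟩ := Finset.not_subset.1 hAT
      exact Finset.prod_eq_zero (Finset.mem_sdiff.2 ⟨hA hpA, hpT⟩) (by simp [hpA])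
  have hsq : ∀ d ∈ S, Squarefree d := fun d hd => (Finset.mem_filter.1 hd).2.1
  have hterm : ∀ d₁ ∈ S, ∀ d₂ ∈ S, lam d₁ * lam d₂ * Ω.density (Nat.lcm d₁ d₂) =
      ∑ T ∈ P.powerset, w T * ((lam d₁ * if d₁.primeFactors ⊆ T then 1 else 0) *
        (lam d₂ * if d₂.primeFactors ⊆ T then 1 else 0)) := by
    intro d₁ h₁ d₂ h₂
    have hs : Squarefree (Nat.lcm d₁ d₂) := by
      rw [Nat.squarefree_iff_factorization_le_one
        (Nat.lcm_ne_zero (hsq _ h₁).ne_zero (hsq _ h₂).ne_zero)]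
      intro p
      rw [Nat.factorization_lcm (hsq _ h₁).ne_zero (hsq _ h₂).ne_zero]
      exact sup_le ((hsq _ h₁).natFactorization_le_one p) ((hsq _ h₂).natFactorization_le_one p)
    have hu : (Nat.lcm d₁ d₂).primeFactors = d₁.primeFactors ∪ d₂.primeFactors := by
      ext p
      simp only [Nat.mem_primeFactors, Finset.mem_union]
      have e₁ := (hsq _ h₁).ne_zero
      have e₂ := (hsq _ h₂).ne_zero
      have e₃ := Nat.lcm_ne_zero e₁ e₂
      constructor
      · rintro ⟨hp, hd, -⟩
        rcases (hp.dvd_lcm).1 hd with h | h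
        · exact Or.inl ⟨hp, h, e₁⟩
        · exact Or.inr ⟨hp, h, e₂⟩
      · rintro (⟨hp, hd, -⟩ | ⟨hp, hd, -⟩)
        · exact ⟨hp, hd.trans (Nat.dvd_lcm_left _ _), e₃⟩
        · exact ⟨hp, hd.trans (Nat.dvd_lcm_right _ _), e₃⟩
    have hsub : ∀ d ∈ S, d.primeFactors ⊆ P := fun d hd =>
      Finset.subset_biUnion_of_mem Nat.primeFactors hd
    rw [Ω.density_eq hs, hu,
      hexp _ (Finset.union_subset (hsub _ h₁) (hsub _ h₂)), Finset.mul_sum]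
    refine Finset.sum_congr rfl fun T _ => ?_
    simp only [Finset.union_subset_iff, ite_and]
    split_ifs <;> ring
  have hform : Ω.selbergForm W₀ z R lam =
      ∑ T ∈ P.powerset, w T * (∑ d ∈ S, lam d * if d.primeFactors ⊆ T then 1 else 0) ^ 2 := by
    rw [selbergForm]
    calc _ = ∑ d₁ ∈ S, ∑ d₂ ∈ S, ∑ T ∈ P.powerset,
            w T * ((lam d₁ * if d₁.primeFactors ⊆ T then 1 else 0) *
              (lam d₂ * if d₂.primeFactors ⊆ T then 1 else 0)) :=
          Finset.sum_congr rfl fun d₁ h₁ => Finset.sum_congr rfl fun d₂ h₂ => hterm d₁ h₁ d₂ h₂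
      _ = ∑ d₁ ∈ S, ∑ T ∈ P.powerset, ∑ d₂ ∈ S,
            w T * ((lam d₁ * if d₁.primeFactors ⊆ T then 1 else 0) *
              (lam d₂ * if d₂.primeFactors ⊆ T then 1 else 0)) :=
          Finset.sum_congr rfl fun _ _ => Finset.sum_comm
      _ = _ := by
          rw [Finset.sum_comm]
          refine Finset.sum_congr rfl fun T _ => ?_
          rw [sq, Finset.sum_mul_sum, Finset.mul_sum]
          exact Finset.sum_congr rfl fun _ _ => (Finset.mul_sum _ _ _).symm
  rw [hform]
  refine Finset.sum_nonneg fun T hT => mul_nonneg (mul_nonneg ?_ ?_) (sq_nonneg _)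
  · exact Finset.prod_nonneg fun p hp => ha0 p (Finset.mem_powerset.1 hT hp)
  · exact Finset.prod_nonneg fun p hp =>
      sub_nonneg.2 (ha1 p (Finset.mem_sdiff.1 hp).1)

/-- The set over which the infimum is taken is bounded below. -/
theorem selbergValues_bddBelow (Ω : ObstructionPattern) (W₀ : ℕ) (z R : ℝ) :
    BddBelow (Ω.selbergValues W₀ z R) := by
  refine ⟨0, ?_⟩
  rintro _ ⟨lam, -, -, rfl⟩
  exact Ω.selbergForm_nonneg W₀ z R lam

end ObstructionPattern

/-- One step of the method of steps for the delay differential equation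
`(u^(-κ) σ(u))' = -κ u^(-κ-1) σ(u-2)`, `u > 2`, with initial data
`σ(u) = e^(-γκ) / Γ(κ+1) * (u/2)^κ` for `0 < u ≤ 2` and `σ(u) = 0` for `u ≤ 0`. -/
def selbergSigmaStep (κ : ℝ) (f : ℝ → ℝ) (u : ℝ) : ℝ :=
  if u ≤ 0 then 0
  else if u ≤ 2 then
    Real.exp (-Real.eulerMascheroniConstant * κ) / Real.Gamma (κ + 1) * (u / 2) ^ κ
  else u ^ κ *
    (Real.exp (-Real.eulerMascheroniConstant * κ) / Real.Gamma (κ + 1) * (2 : ℝ) ^ (-κ) -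
      κ * ∫ t in (2 : ℝ)..u, t ^ (-κ - 1) * f (t - 2))

/-- The function `σ_κ` of Selberg's upper-bound sieve (Ankeny--Onishi). The `n`-th
iterate is already the solution of the delay equation on `u ≤ 2 n`. -/
def selbergSigma (κ u : ℝ) : ℝ := (selbergSigmaStep κ)^[⌈u⌉₊] (fun _ => 0) u

theorem selbergSigmaStep_iterate_eq (κ : ℝ) (n : ℕ) : ∀ m : ℕ, n ≤ m → ∀ u : ℝ, u ≤ 2 * n →
    (selbergSigmaStep κ)^[m] (fun _ => 0) u = (selbergSigmaStep κ)^[n] (fun _ => 0) u := by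
  induction n with
  | zero =>
    intro m _ u hu
    have hu0 : u ≤ 0 := by simpa using hu
    cases m with
    | zero => rfl
    | succ m => rw [Function.iterate_succ_apply']; simp [selbergSigmaStep, hu0]
  | succ n ih =>
    intro m hm u hu
    obtain ⟨k, rfl⟩ : ∃ k, m = k + 1 := ⟨m - 1, by omega⟩
    rw [Function.iterate_succ_apply', Function.iterate_succ_apply']
    unfold selbergSigmaStep
    split_ifs with h1 h2
    · rfl
    · rfl
    · congr 3
      refine intervalIntegral.integral_congr fun t ht => ?_
      rw [Set.uIcc_of_le (not_le.1 h2).le] at ht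
      have ht2 : t - 2 ≤ 2 * (n : ℝ) := by
        have := ht.2
        push_cast at hu
        linarith
      exact congrArg (fun x => t ^ (-κ - 1) * x) (ih k (by omega) (t - 2) ht2)

/-- `σ_κ` solves the delay differential equation, in integrated form, with its initial data. -/
theorem selbergSigma_eq (κ u : ℝ) :
    selbergSigma κ u = selbergSigmaStep κ (selbergSigma κ) u := by
  by_cases h1 : u ≤ 0
  · simp [selbergSigma, Nat.ceil_eq_zero.2 h1, selbergSigmaStep, h1]
  obtain ⟨k, hk⟩ : ∃ k, ⌈u⌉₊ = k + 1 :=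
    ⟨⌈u⌉₊ - 1, by have := Nat.ceil_pos.2 (not_le.1 h1); omega⟩
  have hu : u ≤ (k : ℝ) + 1 := by
    have := Nat.le_ceil u
    rw [hk] at this
    exact_mod_cast this
  rw [selbergSigma, hk, Function.iterate_succ_apply']
  unfold selbergSigmaStep
  rw [if_neg h1, if_neg h1]
  split_ifs with h2
  · rfl
  · congr 3
    refine intervalIntegral.integral_congr fun t ht => ?_
    rw [Set.uIcc_of_le (not_le.1 h2).le] at ht
    have htu := ht.2
    have hle : ⌈t - 2⌉₊ ≤ k := by
      refine Nat.ceil_le.2 ?_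
      linarith
    refine congrArg (fun x => t ^ (-κ - 1) * x)
      (selbergSigmaStep_iterate_eq κ ⌈t - 2⌉₊ k hle (t - 2) ?_)
    have := Nat.le_ceil (t - 2)
    have h0 : (0 : ℝ) ≤ (⌈t - 2⌉₊ : ℝ) := Nat.cast_nonneg _
    linarith

/-- The upper-bound sieve function of dimension `κ` of Selberg's sieve, `F_κ(s) = 1 / σ_κ(2 s)`,
where `s = log R / log z` and the coefficients `λ_d` are supported on `d ≤ R` (so that the sieve
has level `R²`, and `2 s = log R² / log z`). -/
def upperSieveFunction (κ s : ℝ) : ℝ := 1 / selbergSigma κ (2 * s)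

end

/-! Let `T` be a random set of sieving primes that contains each `p` independently with probability
`ω(p)/(p-1)`. Then `g([d₁, d₂])` is the probability that `T` contains every prime factor of `d₁ d₂`,
so the Selberg form is the second moment of `∑ λ_d` over the `d` dividing `∏ T`. Expanding this sum
in an orthogonal system adapted to the product measure (Selberg's diagonalisation,
`exists_selberg_coefficients`) produces coefficients for which the form equals `Weak_loc / P(∏ T ≤
R)`. It remains to bound `P(∏ T ≤ z^s)` from below.

The event `∏ T ≤ z^s` is decreasing in `T`, so it becomes less likely when inclusion probabilities
grow or primes are added. The worst case is therefore the set of all primes `p ≤ z` with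
probabilities `min(1, κ/(p-1))` (`extremalSmallProb_le`). This case depends on neither `Ω` nor `W₀`,
which is where the uniformity comes from.

For the extremal set put `Y = log ∏ T / log z`. By independence `E e^(-νY)` is a product over
primes, and Mertens' theorem gives its limit `exp(-κ Ein(ν))`, with `Ein(ν) = ∫₀^ν (1 - e^(-t))/t
dt`. On the sieve side, the delay equation turns into a first-order linear differential equation for
the Laplace transform of the derivative of `y ↦ σ_κ(2y)`; its solution is the same function, the
factor `e^(-γκ)/Γ(κ+1)` being exactly what makes the constant equal to 1 (`selbergLaplace_eq_exp`).
Approximating an indicator by polynomials in `e^(-Y)` yields `liminf P(Y ≤ s) ≥ σ_κ(2s)`. Only this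
half of the convergence in distribution is needed.

Two degenerate situations are treated directly: a prime with all reduced classes forbidden, where
both sides are compared with 0, and those `z` for which the extremal probability vanishes, which are
bounded and absorbed in `η`. -/

noncomputable section

/-! ### Mertens' first theorem -/

open Nat in
theorem log_factorial_eq_sum_primesLE (n : ℕ) :
    Real.log (n ! : ℕ) = ∑ p ∈ Nat.primesLE n, ((n !).factorization p : ℝ) * Real.log p := by
  rw [Real.log_nat_eq_sum_factorization, Finsupp.sum]
  refine Finset.sum_subset (fun p hp => ?_) fun p _ hp => ?_
  · rw [Nat.support_factorization, Nat.mem_primeFactors] at hp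
    exact Nat.mem_primesLE.2 ⟨(hp.1.dvd_factorial).1 hp.2.1, hp.1⟩
  · simp [Finsupp.notMem_support_iff.1 hp]

/-- Comparison with `n^(-3/2)` through `log n ≤ 2 n^(1/2)`. The sum bounds the contribution of
higher prime powers to `log n!`, since `1/(p-1) - 1/p = 1/(p(p-1))`. -/
theorem summable_log_div_mul_sub_one :
    Summable fun n : ℕ => Real.log n / ((n : ℝ) * ((n : ℝ) - 1)) := by
  have h : Summable fun n : ℕ => 4 * (1 / (n : ℝ) ^ (3 / 2 : ℝ)) :=
    (Real.summable_one_div_nat_rpow.2 (by norm_num)).mul_left 4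
  refine h.of_norm_bounded_eventually_nat ?_
  filter_upwards [eventually_ge_atTop 2] with n hn
  have hn' : (2 : ℝ) ≤ n := by exact_mod_cast hn
  have h0 : (0 : ℝ) < n := by linarith
  rw [Real.norm_of_nonneg (div_nonneg (Real.log_nonneg (by linarith))
    (mul_nonneg h0.le (by linarith)))]
  have h1 := Real.log_natCast_le_rpow_div n (ε := 1 / 2) (by norm_num)
  have h2 : (n : ℝ) ^ (1 / 2 : ℝ) * (n : ℝ) ^ (3 / 2 : ℝ) = n ^ 2 := by
    rw [← Real.rpow_add h0, ← Real.rpow_natCast]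
    norm_num
  have h3 : 0 < (n : ℝ) ^ (3 / 2 : ℝ) := Real.rpow_pos_of_pos h0 _
  rw [mul_one_div, div_le_div_iff₀ (mul_pos h0 (by linarith)) h3]
  calc Real.log n * (n : ℝ) ^ (3 / 2 : ℝ) ≤ (n : ℝ) ^ (1 / 2 : ℝ) / (1 / 2) * (n : ℝ) ^ (3 / 2 : ℝ) := by
        gcongr
    _ = 2 * n ^ 2 := by rw [← h2]; ring
    _ ≤ 4 * (n * ((n : ℝ) - 1)) := by nlinarith

/-- Mertens' first theorem. -/
theorem exists_abs_sum_log_div_sub_log_le :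
    ∃ C : ℝ, 0 ≤ C ∧ ∀ x : ℝ, 1 ≤ x →
      |∑ p ∈ Nat.primesLE ⌊x⌋₊, Real.log p / p - Real.log x| ≤ C := by
  set B : ℝ := ∑' n : ℕ, Real.log n / ((n : ℝ) * ((n : ℝ) - 1)) with hB
  have hterm : ∀ n : ℕ, 0 ≤ Real.log n / ((n : ℝ) * ((n : ℝ) - 1)) := by
    intro n
    rcases n with _ | n
    · simp
    · refine div_nonneg (Real.log_natCast_nonneg _) (mul_nonneg (Nat.cast_nonneg _) ?_)
      push_cast
      linarith [n.cast_nonneg (α := ℝ)]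
  have hB0 : 0 ≤ B := tsum_nonneg hterm
  -- From below the error is `B` (prime powers), `1` (Stirling) and `log 2` (passing from `x` to its
  -- floor); from above it is `log 4` (Chebyshev).
  refine ⟨B + Real.log 4 + 1 + Real.log 2, by positivity, fun x hx => ?_⟩
  set n := ⌊x⌋₊ with hn
  have hn1 : 1 ≤ n := (Nat.one_le_floor_iff x).2 hx
  have hn0 : (0 : ℝ) < n := by exact_mod_cast hn1
  have hnx : (n : ℝ) ≤ x := Nat.floor_le (by linarith)
  have hxn : x ≤ 2 * n := by
    have := Nat.lt_floor_add_one x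
    have : (1 : ℝ) ≤ n := by exact_mod_cast hn1
    linarith
  have hl1 : Real.log n ≤ Real.log x := Real.log_le_log hn0 hnx
  have hl2 : Real.log x ≤ Real.log 2 + Real.log n := by
    rw [← Real.log_mul (by norm_num) hn0.ne']
    exact Real.log_le_log (by linarith) hxn
  have hl4 : 0 ≤ Real.log 4 := Real.log_nonneg (by norm_num)
  have hl20 : 0 ≤ Real.log 2 := Real.log_nonneg (by norm_num)
  have hfac := log_factorial_eq_sum_primesLE n
  have hup : Real.log (n.factorial : ℕ) ≤ n * Real.log n := by
    rw [← Real.log_pow]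
    exact Real.log_le_log (by exact_mod_cast n.factorial_pos) (by exact_mod_cast n.factorial_le_pow)
  have hlow : n * Real.log n - n ≤ Real.log (n.factorial : ℕ) := by
    have h1 := Stirling.le_log_factorial_stirling (n := n) (by omega)
    have h2 : 0 ≤ Real.log n := Real.log_natCast_nonneg _
    have h3 : 0 ≤ Real.log (2 * Real.pi) := Real.log_nonneg (by linarith [Real.pi_gt_three])
    linarith
  have htheta : ∑ p ∈ Nat.primesLE n, Real.log p ≤ Real.log 4 * n := by
    rw [← Chebyshev.theta_eq_sum_primesLE_log]
    exact Chebyshev.theta_le_log4_mul_x hn0.le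
  -- Replacing `n/p` by its floor loses at most `log p` for each prime, in total `θ(n) ≤ n log 4`.
  have hS1 : n * ∑ p ∈ Nat.primesLE n, Real.log p / p ≤
      Real.log (n.factorial : ℕ) + ∑ p ∈ Nat.primesLE n, Real.log p := by
    rw [hfac, Finset.mul_sum, ← Finset.sum_add_distrib]
    refine Finset.sum_le_sum fun p hp => ?_
    have hpp := Nat.prime_of_mem_primesLE hp
    have h1 : n / p ≤ n.factorial.factorization p := by
      rw [Nat.factorization_factorial hpp (Nat.lt_add_one (Nat.log p n))]
      have : 1 ∈ Finset.Ico 1 (Nat.log p n + 1) := by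
        simp [Nat.log_pos hpp.one_lt (Nat.le_of_mem_primesLE hp)]
      simpa using Finset.single_le_sum (f := fun i => n / p ^ i) (fun _ _ => Nat.zero_le _) this
    have h2 : (n : ℝ) / p ≤ n.factorial.factorization p + 1 := by
      have h3 := Nat.lt_floor_add_one ((n : ℝ) / p)
      rw [Nat.floor_div_natCast, Nat.floor_natCast] at h3
      have h4 : ((n / p : ℕ) : ℝ) ≤ n.factorial.factorization p := by exact_mod_cast h1
      linarith
    have h5 := mul_le_mul_of_nonneg_right h2 (Real.log_natCast_nonneg p)
    calc (n : ℝ) * (Real.log p / p) = n / p * Real.log p := by ring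
      _ ≤ _ := h5
      _ = _ := by ring
  have hS2 : Real.log (n.factorial : ℕ) ≤
      n * (∑ p ∈ Nat.primesLE n, Real.log p / p + B) := by
    have hBs : ∑ p ∈ Nat.primesLE n, Real.log p / ((p : ℝ) * ((p : ℝ) - 1)) ≤ B :=
      summable_log_div_mul_sub_one.sum_le_tsum _ fun i _ => hterm i
    refine le_trans ?_ (mul_le_mul_of_nonneg_left (add_le_add_right hBs _) hn0.le)
    rw [hfac, ← Finset.sum_add_distrib, Finset.mul_sum]
    refine Finset.sum_le_sum fun p hp => ?_
    have hpp := Nat.prime_of_mem_primesLE hp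
    have hp2 : (2 : ℝ) ≤ p := by exact_mod_cast hpp.two_le
    have h1 : (n.factorial.factorization p : ℝ) ≤ n / ((p : ℝ) - 1) := by
      have h2 : (n.factorial.factorization p : ℝ) ≤ ((n / (p - 1) : ℕ) : ℝ) := by
        exact_mod_cast Nat.factorization_factorial_le_div_pred hpp n
      refine h2.trans (Nat.cast_div_le.trans ?_)
      rw [Nat.cast_sub hpp.one_le, Nat.cast_one]
    have h5 := mul_le_mul_of_nonneg_right h1 (Real.log_natCast_nonneg p)
    refine h5.trans (le_of_eq ?_)
    have : (p : ℝ) - 1 ≠ 0 := by linarith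
    have : (p : ℝ) ≠ 0 := by linarith
    field_simp
    ring
  rw [abs_le]
  constructor
  · have : n * (Real.log n - 1) ≤ n * (∑ p ∈ Nat.primesLE n, Real.log p / p + B) := by linarith
    have := le_of_mul_le_mul_left this hn0
    linarith
  · have : n * ∑ p ∈ Nat.primesLE n, Real.log p / p ≤ n * (Real.log n + Real.log 4) := by linarith
    have := le_of_mul_le_mul_left this hn0
    linarith

/-! ### Smoothed prime sums and the exponential integral -/

theorem integral_rpow_neg_sub_one_one {z δ : ℝ} (hz : 1 ≤ z) (hδ : 0 < δ) :
    ∫ t in (1 : ℝ)..z, t ^ (-δ - 1) = (1 - z ^ (-δ)) / δ := by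
  rw [integral_rpow (Or.inr ⟨by linarith, ?_⟩)]
  · rw [sub_add_cancel, Real.one_rpow]
    field_simp
    ring
  · rw [Set.uIcc_of_le hz]
    exact fun h => by linarith [h.1]

/-- Mertens' first theorem with a smoothing factor `p ^ (-δ)`, uniformly in `δ`. -/
theorem exists_abs_sum_log_div_mul_rpow_sub_le :
    ∃ C : ℝ, 0 ≤ C ∧ ∀ z δ : ℝ, 1 ≤ z → 0 < δ →
      |∑ p ∈ Nat.primesLE ⌊z⌋₊, Real.log p / p * (p : ℝ) ^ (-δ) - (1 - z ^ (-δ)) / δ| ≤ C := by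
  obtain ⟨C, hC0, hC⟩ := exists_abs_sum_log_div_sub_log_le
  refine ⟨C, hC0, fun z δ hz hδ => ?_⟩
  set c : ℕ → ℝ := fun k => if k.Prime then Real.log k / k else 0 with hc
  have hcs : ∀ m : ℕ, ∑ k ∈ Finset.Icc 0 m, c k = ∑ p ∈ Nat.primesLE m, Real.log p / p := by
    intro m
    rw [Nat.primesLE_eq_filter_Icc_zero, Finset.sum_filter]
  have hder : ∀ t ∈ Set.Icc 1 z, HasDerivAt (fun t : ℝ => t ^ (-δ)) (-δ * t ^ (-δ - 1)) t :=
    fun t ht => Real.hasDerivAt_rpow_const (Or.inl (by linarith [ht.1]))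
  have hcont : ContinuousOn (fun t : ℝ => -δ * t ^ (-δ - 1)) (Set.Icc 1 z) :=
    ContinuousOn.mul continuousOn_const
      (ContinuousOn.rpow_const continuousOn_id fun t ht => Or.inl (by
        have := ht.1
        linarith))
  have hintd : MeasureTheory.IntegrableOn (fun t : ℝ => -δ * t ^ (-δ - 1)) (Set.Icc 1 z) :=
    hcont.integrableOn_Icc
  have hintd' : MeasureTheory.IntegrableOn (deriv fun t : ℝ => t ^ (-δ)) (Set.Icc 1 z) :=
    hintd.congr_fun (fun t ht => (hder t ht).deriv.symm) measurableSet_Icc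
  have habel := sum_mul_eq_sub_integral_mul₀ (c := c) (f := fun t : ℝ => t ^ (-δ)) (by simp [hc]) z
    (fun t ht => (hder t ht).differentiableAt) hintd'
  have hL : ∑ k ∈ Finset.Icc 0 ⌊z⌋₊, (k : ℝ) ^ (-δ) * c k =
      ∑ p ∈ Nat.primesLE ⌊z⌋₊, Real.log p / p * (p : ℝ) ^ (-δ) := by
    rw [Nat.primesLE_eq_filter_Icc_zero, Finset.sum_filter]
    refine Finset.sum_congr rfl fun k _ => ?_
    simp only [hc]
    split_ifs <;> ring
  have hI : ∫ t in Set.Ioc 1 z, deriv (fun t : ℝ => t ^ (-δ)) t * ∑ k ∈ Finset.Icc 0 ⌊t⌋₊, c k =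
      ∫ t in (1 : ℝ)..z, -δ * t ^ (-δ - 1) * ∑ k ∈ Finset.Icc 0 ⌊t⌋₊, c k := by
    rw [intervalIntegral.integral_of_le hz]
    refine MeasureTheory.setIntegral_congr_fun measurableSet_Ioc fun t ht => ?_
    simp only [(hder t (Set.Ioc_subset_Icc_self ht)).deriv]
  have hi1 : IntervalIntegrable (fun t : ℝ => -δ * t ^ (-δ - 1) * ∑ k ∈ Finset.Icc 0 ⌊t⌋₊, c k)
      MeasureTheory.volume 1 z := by
    rw [intervalIntegrable_iff_integrableOn_Icc_of_le hz]
    exact integrableOn_mul_sum_Icc c zero_le_one hintd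
  have hlogc : ContinuousOn (fun t : ℝ => Real.log t) (Set.Icc 1 z) :=
    Real.continuousOn_log.mono fun t ht => by
      have := ht.1
      simp only [Set.mem_compl_iff, Set.mem_singleton_iff]
      linarith
  have hi2 : IntervalIntegrable (fun t : ℝ => -δ * t ^ (-δ - 1) * Real.log t)
      MeasureTheory.volume 1 z := by
    refine ContinuousOn.intervalIntegrable ?_
    rw [Set.uIcc_of_le hz]
    exact hcont.mul hlogc
  have hi3 : IntervalIntegrable (fun t : ℝ => t ^ (-δ - 1)) MeasureTheory.volume 1 z := by
    refine ContinuousOn.intervalIntegrable ?_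
    rw [Set.uIcc_of_le hz]
    exact ContinuousOn.rpow_const continuousOn_id fun t ht => Or.inl (by
        have := ht.1
        linarith)
  -- This is the Abel integral with the prime sum replaced by `log t`; it supplies the main term `(1
  -- - z^(-δ))/δ`, and what remains involves only the Mertens error.
  have hparts : ∫ t in (1 : ℝ)..z, -δ * t ^ (-δ - 1) * Real.log t =
      z ^ (-δ) * Real.log z - (1 - z ^ (-δ)) / δ := by
    have h := intervalIntegral.integral_mul_deriv_eq_deriv_mul (a := 1) (b := z)
      (u := Real.log) (u' := fun t => t⁻¹) (v := fun t => t ^ (-δ))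
      (v' := fun t => -δ * t ^ (-δ - 1))
      (fun t ht => by
        rw [Set.uIcc_of_le hz] at ht
        exact Real.hasDerivAt_log (by linarith [ht.1]))
      (fun t ht => by
        rw [Set.uIcc_of_le hz] at ht
        exact hder t ht)
      (by
        refine ContinuousOn.intervalIntegrable ?_
        rw [Set.uIcc_of_le hz]
        exact continuousOn_inv₀.mono fun t ht => by
          have := ht.1
          simp only [Set.mem_compl_iff, Set.mem_singleton_iff]
          linarith)
      (by
        refine ContinuousOn.intervalIntegrable ?_
        rwa [Set.uIcc_of_le hz])
    rw [← integral_rpow_neg_sub_one_one hz hδ]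
    have h2 : ∫ t in (1 : ℝ)..z, t⁻¹ * t ^ (-δ) = ∫ t in (1 : ℝ)..z, t ^ (-δ - 1) := by
      refine intervalIntegral.integral_congr fun t ht => ?_
      rw [Set.uIcc_of_le hz] at ht
      rw [Real.rpow_sub_one (by linarith [ht.1])]
      ring
    rw [h2, Real.log_one] at h
    rw [show (fun t : ℝ => -δ * t ^ (-δ - 1) * Real.log t) =
      fun t => Real.log t * (-δ * t ^ (-δ - 1)) from funext fun t => by ring, h]
    ring
  rw [hL, hI] at habel
  have hkey : ∑ p ∈ Nat.primesLE ⌊z⌋₊, Real.log p / p * (p : ℝ) ^ (-δ) - (1 - z ^ (-δ)) / δ =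
      z ^ (-δ) * (∑ k ∈ Finset.Icc 0 ⌊z⌋₊, c k - Real.log z) -
        ∫ t in (1 : ℝ)..z, -δ * t ^ (-δ - 1) *
          (∑ k ∈ Finset.Icc 0 ⌊t⌋₊, c k - Real.log t) := by
    have : ∫ t in (1 : ℝ)..z, -δ * t ^ (-δ - 1) * (∑ k ∈ Finset.Icc 0 ⌊t⌋₊, c k - Real.log t) =
        (∫ t in (1 : ℝ)..z, -δ * t ^ (-δ - 1) * ∑ k ∈ Finset.Icc 0 ⌊t⌋₊, c k) -
        ∫ t in (1 : ℝ)..z, -δ * t ^ (-δ - 1) * Real.log t := by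
      rw [← intervalIntegral.integral_sub hi1 hi2]
      exact intervalIntegral.integral_congr fun t _ => by ring
    rw [this, hparts, habel]
    ring
  rw [hkey]
  have hb1 : |z ^ (-δ) * (∑ k ∈ Finset.Icc 0 ⌊z⌋₊, c k - Real.log z)| ≤ z ^ (-δ) * C := by
    rw [abs_mul, abs_of_nonneg (Real.rpow_nonneg (by linarith) _), hcs]
    exact mul_le_mul_of_nonneg_left (hC z hz) (Real.rpow_nonneg (by linarith) _)
  have hb2 : |∫ t in (1 : ℝ)..z, -δ * t ^ (-δ - 1) *
      (∑ k ∈ Finset.Icc 0 ⌊t⌋₊, c k - Real.log t)| ≤ ∫ t in (1 : ℝ)..z, δ * C * t ^ (-δ - 1) := by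
    rw [← Real.norm_eq_abs]
    refine intervalIntegral.norm_integral_le_of_norm_le hz ?_ (hi3.const_mul _)
    refine Eventually.of_forall fun t ht => ?_
    rw [norm_mul, norm_mul, norm_neg, Real.norm_of_nonneg hδ.le,
      Real.norm_of_nonneg (Real.rpow_nonneg (by linarith [ht.1]) _), Real.norm_eq_abs, hcs]
    have := mul_le_mul_of_nonneg_left (hC t ht.1.le)
      (mul_nonneg hδ.le (Real.rpow_nonneg (by linarith [ht.1] : (0 : ℝ) ≤ t) (-δ - 1)))
    linarith
  rw [intervalIntegral.integral_const_mul, integral_rpow_neg_sub_one_one hz hδ] at hb2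
  -- The boundary term costs `C z^(-δ)` and the integral `C (1 - z^(-δ))`, which add up to `C`
  -- whatever `z` and `δ` are.
  refine (abs_sub _ _).trans ((add_le_add hb1 hb2).trans (le_of_eq ?_))
  field_simp
  ring

/-- The entire exponential integral `∫₀^x (1 - e^(-t)) / t dt`. -/
def einIntegral (x : ℝ) : ℝ := ∫ t in (0 : ℝ)..x, (1 - Real.exp (-t)) / t

theorem one_sub_exp_neg_div_mem_Icc {t : ℝ} (ht : 0 ≤ t) :
    (1 - Real.exp (-t)) / t ∈ Set.Icc (0 : ℝ) 1 := by
  constructor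
  · exact div_nonneg (by linarith [Real.exp_le_one_iff.2 (neg_nonpos.2 ht)]) ht
  · exact div_le_one_of_le₀ (by linarith [Real.add_one_le_exp (-t)]) ht

theorem intervalIntegrable_one_sub_exp_neg_div {x : ℝ} (hx : 0 ≤ x) :
    IntervalIntegrable (fun t : ℝ => (1 - Real.exp (-t)) / t) MeasureTheory.volume 0 x := by
  refine (intervalIntegrable_const (c := (1 : ℝ))).mono_fun ?_ ?_
  · exact (((Real.measurable_exp.comp measurable_neg).const_sub 1).div
      measurable_id).aestronglyMeasurable
  · refine (MeasureTheory.ae_restrict_iff' measurableSet_uIoc).2 (Eventually.of_forall fun t ht => ?_)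
    rw [Set.uIoc_of_le hx] at ht
    have h := one_sub_exp_neg_div_mem_Icc ht.1.le
    beta_reduce
    rw [Real.norm_of_nonneg h.1, norm_one]
    exact h.2

/-- The derivative of the sum in `ν` is the smoothed Mertens sum at `δ = ν / log z`, divided by `log
z`. The Mertens error is uniform in `δ`, so integrating over `[0, ν]` costs only `C ν / log z`. -/
theorem exists_abs_sum_one_sub_rpow_div_sub_einIntegral_le :
    ∃ C : ℝ, 0 ≤ C ∧ ∀ z ν : ℝ, 1 < z → 0 ≤ ν →
      |∑ p ∈ Nat.primesLE ⌊z⌋₊, (1 - (p : ℝ) ^ (-(ν / Real.log z))) / p - einIntegral ν| ≤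
        C * ν / Real.log z := by
  obtain ⟨C, hC0, hC⟩ := exists_abs_sum_log_div_mul_rpow_sub_le
  refine ⟨C, hC0, fun z ν hz hν => ?_⟩
  have hl : 0 < Real.log z := Real.log_pos hz
  set G : ℝ → ℝ := fun v =>
    ∑ p ∈ Nat.primesLE ⌊z⌋₊, Real.log p / p * (p : ℝ) ^ (-(v / Real.log z)) with hG
  have hterm : ∀ p ∈ Nat.primesLE ⌊z⌋₊, Continuous fun v : ℝ =>
      Real.log p / p * (p : ℝ) ^ (-(v / Real.log z)) := by
    intro p hp
    have hp0 : (0 : ℝ) < p := by exact_mod_cast (Nat.prime_of_mem_primesLE hp).pos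
    refine continuous_const.mul (Continuous.rpow continuous_const
      (continuous_id.div_const _).neg fun _ => Or.inl hp0.ne')
  have hGc : Continuous G := continuous_finsetSum _ hterm
  have hGi : ∫ v in (0 : ℝ)..ν, G v / Real.log z =
      ∑ p ∈ Nat.primesLE ⌊z⌋₊, (1 - (p : ℝ) ^ (-(ν / Real.log z))) / p := by
    simp only [hG, Finset.sum_div]
    rw [intervalIntegral.integral_finsetSum fun p hp =>
      ((hterm p hp).div_const _).intervalIntegrable _ _]
    refine Finset.sum_congr rfl fun p hp => ?_
    have hp0 : (0 : ℝ) < p := by exact_mod_cast (Nat.prime_of_mem_primesLE hp).pos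
    have hd : ∀ v ∈ Set.uIcc 0 ν, HasDerivAt (fun v : ℝ => -((p : ℝ) ^ (-(v / Real.log z)) / p))
        (Real.log p / p * (p : ℝ) ^ (-(v / Real.log z)) / Real.log z) v := by
      intro v _
      have h1 : HasDerivAt (fun v : ℝ => -(v / Real.log z)) (-(1 / Real.log z)) v :=
        ((hasDerivAt_id v).div_const _).neg
      have h2 := ((h1.const_rpow hp0).div_const (p : ℝ)).neg
      convert! h2 using 1
      field_simp
    rw [intervalIntegral.integral_eq_sub_of_hasDerivAt hd
      (((hterm p hp).div_const _).intervalIntegrable _ _)]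
    simp
    ring
  rw [← hGi, einIntegral, ← intervalIntegral.integral_sub
    ((hGc.div_const _).intervalIntegrable _ _) (intervalIntegrable_one_sub_exp_neg_div hν)]
  have hb := intervalIntegral.norm_integral_le_of_norm_le_const (a := 0) (b := ν)
    (f := fun v => G v / Real.log z - (1 - Real.exp (-v)) / v) (C := C / Real.log z) (by
      intro v hv
      rw [Set.uIoc_of_le hν] at hv
      have h1 := hC z (v / Real.log z) hz.le (div_pos hv.1 hl)
      have h2 : z ^ (-(v / Real.log z)) = Real.exp (-v) := by
        rw [Real.rpow_def_of_pos (by linarith)]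
        congr 1
        field_simp
      rw [h2] at h1
      have h3 : G v / Real.log z - (1 - Real.exp (-v)) / v =
          (G v - (1 - Real.exp (-v)) / (v / Real.log z)) / Real.log z := by
        have := hv.1.ne'
        field_simp
      rw [h3, norm_div, Real.norm_eq_abs, Real.norm_of_nonneg hl.le]
      exact div_le_div_of_nonneg_right h1 hl.le)
  rw [Real.norm_eq_abs, sub_zero, abs_of_nonneg hν] at hb
  refine hb.trans (le_of_eq ?_)
  ring

theorem tendsto_sum_one_sub_rpow_div {ν : ℝ} (hν : 0 ≤ ν) :
    Tendsto (fun z : ℝ => ∑ p ∈ Nat.primesLE ⌊z⌋₊, (1 - (p : ℝ) ^ (-(ν / Real.log z))) / p)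
      atTop (𝓝 (einIntegral ν)) := by
  obtain ⟨C, -, hC⟩ := exists_abs_sum_one_sub_rpow_div_sub_einIntegral_le
  rw [tendsto_iff_dist_tendsto_zero]
  refine squeeze_zero' (Eventually.of_forall fun _ => dist_nonneg) ?_
    (tendsto_const_nhds.div_atTop (a := C * ν) Real.tendsto_log_atTop)
  filter_upwards [eventually_gt_atTop 1] with z hz
  exact hC z ν hz hν

/-! ### Limit of the Laplace transform of the extremal random set -/

/-- The inclusion probability `min(1, κ / (p - 1))` of the extremal pattern. -/
def extremalProb (κ : ℝ) (p : ℕ) : ℝ := min 1 (κ / ((p : ℝ) - 1))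

theorem extremalProb_nonneg {κ : ℝ} (hκ : 0 ≤ κ) {p : ℕ} (hp : p.Prime) : 0 ≤ extremalProb κ p := by
  have : (1 : ℝ) < p := by exact_mod_cast hp.one_lt
  exact le_min zero_le_one (div_nonneg hκ (by linarith))

theorem extremalProb_le_one (κ : ℝ) (p : ℕ) : extremalProb κ p ≤ 1 := min_le_left _ _

theorem rpow_neg_div_log_mem_Icc {ν z : ℝ} (hν : 0 ≤ ν) (hz : 1 < z) {p : ℕ}
    (hp : p ∈ Nat.primesLE ⌊z⌋₊) :
    (p : ℝ) ^ (-(ν / Real.log z)) ∈ Set.Icc (Real.exp (-ν)) 1 := by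
  have hl : 0 < Real.log z := Real.log_pos hz
  have hp1 : (1 : ℝ) < p := by exact_mod_cast Nat.one_lt_of_mem_primesLE hp
  have hpz : (p : ℝ) ≤ z := (Nat.le_floor_iff (by linarith)).1 (Nat.le_of_mem_primesLE hp)
  constructor
  · have h2 : z ^ (-(ν / Real.log z)) = Real.exp (-ν) := by
      rw [Real.rpow_def_of_pos (by linarith)]
      congr 1
      field_simp
    rw [← h2]
    exact Real.rpow_le_rpow_of_nonpos (by linarith) hpz (neg_nonpos.2 (div_nonneg hν hl.le))
  · exact Real.rpow_le_one_of_one_le_of_nonpos hp1.le (neg_nonpos.2 (div_nonneg hν hl.le))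

/-- The right side is at least `q`, so Euler factors stay away from 0 even at small primes where `a
= 1`. -/
theorem le_one_sub_mul_one_sub {a q c : ℝ} (ha1 : a ≤ 1) (hq1 : q ≤ 1)
    (hq : c ≤ q) : c ≤ 1 - a * (1 - q) := by
  nlinarith

/-- For `p ≥ 4κ + 4` the minimum in `extremalProb` is `κ/(p-1) ≤ 2κ/p ≤ 1/2`. The second-order term
of the logarithm then costs `8κ²/p²`, and passing from `κ/(p-1)` to `κ/p` costs `2κ/p²`. -/
theorem abs_log_one_sub_add_le {κ x : ℝ} (hκ : 0 ≤ κ) (hx0 : 0 ≤ x) (hx1 : x ≤ 1) {p : ℕ}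
    (hp : 4 * κ + 4 ≤ p) :
    |Real.log (1 - extremalProb κ p * x) + κ * (x / p)| ≤ (8 * κ ^ 2 + 2 * κ) / (p : ℝ) ^ 2 := by
  have hp4 : (4 : ℝ) ≤ p := by linarith
  have hp0 : (0 : ℝ) < p := by linarith
  have hp1 : 0 < (p : ℝ) - 1 := by linarith
  have ha : extremalProb κ p = κ / ((p : ℝ) - 1) := by
    refine min_eq_right ?_
    rw [div_le_one hp1]
    linarith
  have ha2 : κ / ((p : ℝ) - 1) ≤ 2 * κ / p := by
    rw [div_le_div_iff₀ hp1 hp0]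
    nlinarith
  have ha3 : 2 * κ / p ≤ 1 / 2 := by
    rw [div_le_div_iff₀ hp0 (by norm_num)]
    linarith
  rw [ha]
  set a := κ / ((p : ℝ) - 1) with had
  have ha0 : 0 ≤ a := div_nonneg hκ hp1.le
  have hy0 : 0 ≤ a * x := mul_nonneg ha0 hx0
  have hya : a * x ≤ a := mul_le_of_le_one_right ha0 hx1
  have h1 := Real.abs_log_sub_add_sum_range_le (x := a * x)
    (by rw [abs_of_nonneg hy0]; linarith) 1
  simp only [Finset.sum_range_one, zero_add, pow_one, Nat.cast_zero, div_one,
    abs_of_nonneg hy0] at h1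
  have h2 : (a * x) ^ (1 + 1) / (1 - a * x) ≤ 8 * κ ^ 2 / (p : ℝ) ^ 2 := by
    have h3 : (a * x) ^ (1 + 1) ≤ (2 * κ / p) ^ 2 :=
      pow_le_pow_left₀ hy0 (hya.trans ha2) 2
    have h4 : (1 : ℝ) / 2 ≤ 1 - a * x := by linarith
    calc (a * x) ^ (1 + 1) / (1 - a * x) ≤ (2 * κ / p) ^ 2 / (1 / 2) :=
          div_le_div₀ (sq_nonneg _) h3 (by norm_num) h4
      _ = _ := by ring
  have h5 : |κ * (x / p) - a * x| ≤ 2 * κ / (p : ℝ) ^ 2 := by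
    have h6 : κ * (x / p) - a * x = -(x * (κ / (p * ((p : ℝ) - 1)))) := by
      rw [had]
      field_simp
      ring
    have h7 : 0 ≤ κ / (p * ((p : ℝ) - 1)) := div_nonneg hκ (by positivity)
    rw [h6, abs_neg, abs_of_nonneg (mul_nonneg hx0 h7)]
    refine (mul_le_of_le_one_left h7 hx1).trans ?_
    rw [div_le_div_iff₀ (by positivity) (by positivity)]
    nlinarith [mul_nonneg hκ (mul_nonneg hp0.le (by linarith : (0 : ℝ) ≤ p - 2))]
  calc |Real.log (1 - a * x) + κ * (x / p)|
      = |(a * x + Real.log (1 - a * x)) + (κ * (x / p) - a * x)| := by congr 1; ring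
    _ ≤ 8 * κ ^ 2 / (p : ℝ) ^ 2 + 2 * κ / (p : ℝ) ^ 2 :=
        (abs_add_le _ _).trans (add_le_add (h1.trans h2) h5)
    _ = _ := by ring

/-- Compare the logarithm of each factor with `-κ x/p`, where `x = 1 - p^(-ν/log z)`. The
discrepancy tends to 0 for each fixed `p` and is dominated by a summable sequence, so its sum tends
to 0; the sum of `κ x/p` tends to `κ Ein(ν)`. -/
theorem tendsto_prod_one_sub_extremalProb {κ ν : ℝ} (hκ : 0 ≤ κ) (hν : 0 ≤ ν) :
    Tendsto (fun z : ℝ => ∏ p ∈ Nat.primesLE ⌊z⌋₊,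
      (1 - extremalProb κ p * (1 - (p : ℝ) ^ (-(ν / Real.log z)))))
      atTop (𝓝 (Real.exp (-(κ * einIntegral ν)))) := by
  classical
  set x : ℝ → ℕ → ℝ := fun z p => 1 - (p : ℝ) ^ (-(ν / Real.log z)) with hx
  set f : ℝ → ℕ → ℝ := fun z p => if p ∈ Nat.primesLE ⌊z⌋₊ then
    Real.log (1 - extremalProb κ p * x z p) + κ * (x z p / p) else 0 with hf
  set N : ℕ := ⌈4 * κ + 4⌉₊ with hN
  -- At the finitely many primes below `4κ + 4` no expansion is available; there the factor lies in
  -- `[e^(-ν), 1]`, so its logarithm is at most `ν` in absolute value, and `κ x/p ≤ κ`.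
  set bound : ℕ → ℝ := fun p => (8 * κ ^ 2 + 2 * κ) / (p : ℝ) ^ 2 +
    if p ∈ Finset.range N then ν + κ else 0 with hbound
  have hsum : Summable bound := by
    refine Summable.add ?_ ?_
    · have := (Real.summable_one_div_nat_pow.2 one_lt_two).mul_left (8 * κ ^ 2 + 2 * κ)
      simpa only [mul_one_div] using this
    · exact summable_of_ne_finset_zero (s := Finset.range N) fun p hp => if_neg hp
  have hb : ∀ᶠ z in atTop, ∀ p, ‖f z p‖ ≤ bound p := by
    filter_upwards [eventually_gt_atTop 1] with z hz p
    simp only [hf, hbound]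
    split_ifs with h1 h2 h2
    · have hq := rpow_neg_div_log_mem_Icc hν hz h1
      have hpp := Nat.prime_of_mem_primesLE h1
      have hp1 : (1 : ℝ) ≤ p := by exact_mod_cast hpp.one_le
      have ha0 := extremalProb_nonneg hκ hpp
      have hq0 := Real.exp_pos (-ν)
      have hl := le_one_sub_mul_one_sub (extremalProb_le_one κ p) hq.2 hq.1
      have hxz : 0 ≤ x z p ∧ x z p ≤ 1 := ⟨by simp only [hx]; linarith [hq.2],
        by simp only [hx]; linarith [hq.1]⟩
      have e1 : |Real.log (1 - extremalProb κ p * x z p)| ≤ ν := by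
        rw [abs_le]
        constructor
        · rw [← Real.log_exp (-ν)]
          exact Real.log_le_log hq0 hl
        · refine (Real.log_nonpos (by linarith) ?_).trans hν
          linarith [mul_nonneg ha0 hxz.1]
      have e2 : |κ * (x z p / p)| ≤ κ := by
        rw [abs_of_nonneg (mul_nonneg hκ (div_nonneg hxz.1 (by linarith)))]
        exact mul_le_of_le_one_right hκ (div_le_one_of_le₀ (by linarith) (by linarith))
      rw [Real.norm_eq_abs]
      have e3 : 0 ≤ (8 * κ ^ 2 + 2 * κ) / (p : ℝ) ^ 2 := by positivity
      linarith [abs_add_le (Real.log (1 - extremalProb κ p * x z p)) (κ * (x z p / p))]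
    · have hq := rpow_neg_div_log_mem_Icc hν hz h1
      have hq0 := Real.exp_pos (-ν)
      rw [add_zero, Real.norm_eq_abs]
      refine abs_log_one_sub_add_le hκ (by simp only [hx]; linarith [hq.2])
        (by simp only [hx]; linarith [hq.1]) ?_
      rw [Finset.mem_range, not_lt] at h2
      exact (Nat.le_ceil _).trans (by exact_mod_cast h2)
    · rw [norm_zero]
      positivity
    · rw [norm_zero]
      positivity
  have hpt : ∀ p, Tendsto (fun z => f z p) atTop (𝓝 ((fun _ : ℕ => (0 : ℝ)) p)) := by
    intro p
    by_cases hp : p.Prime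
    · have hp0 : (0 : ℝ) < p := by exact_mod_cast hp.pos
      have hx0 : Tendsto (fun z => x z p) atTop (𝓝 0) := by
        have h1 : Tendsto (fun z : ℝ => -(ν / Real.log z)) atTop (𝓝 (-0)) :=
          (tendsto_const_nhds.div_atTop Real.tendsto_log_atTop).neg
        rw [neg_zero] at h1
        have h2 : Tendsto (fun z : ℝ => (p : ℝ) ^ (-(ν / Real.log z))) atTop (𝓝 ((p : ℝ) ^ (0 : ℝ))) :=
          tendsto_const_nhds.rpow h1 (Or.inl hp0.ne')
        rw [Real.rpow_zero] at h2
        simpa using h2.const_sub 1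
      have h3 : Tendsto (fun z => Real.log (1 - extremalProb κ p * x z p) + κ * (x z p / p)) atTop
          (𝓝 (Real.log (1 - extremalProb κ p * 0) + κ * (0 / p))) := by
        refine Tendsto.add (Tendsto.log ((hx0.const_mul _).const_sub 1) (by simp))
          ((hx0.div_const _).const_mul _)
      simp only [mul_zero, sub_zero, Real.log_one, zero_div, add_zero] at h3
      refine h3.congr' ?_
      filter_upwards [eventually_ge_atTop (p : ℝ)] with z hz
      exact (if_pos (Nat.mem_primesLE.2 ⟨Nat.le_floor hz, hp⟩)).symm
    · refine tendsto_const_nhds.congr fun z => (if_neg fun h => hp ?_).symm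
      exact Nat.prime_of_mem_primesLE h
  have ht := tendsto_tsum_of_dominated_convergence hsum hpt hb
  rw [tsum_zero] at ht
  have ht2 := (ht.sub ((tendsto_sum_one_sub_rpow_div hν).const_mul κ)).rexp
  rw [zero_sub] at ht2
  refine ht2.congr' ?_
  filter_upwards [eventually_gt_atTop 1] with z hz
  have h1 : ∑' p, f z p = ∑ p ∈ Nat.primesLE ⌊z⌋₊,
      (Real.log (1 - extremalProb κ p * x z p) + κ * (x z p / p)) := by
    rw [tsum_eq_sum (s := Nat.primesLE ⌊z⌋₊) fun p hp => if_neg hp]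
    exact Finset.sum_congr rfl fun p hp => if_pos hp
  rw [h1, Finset.sum_add_distrib, Finset.mul_sum, add_sub_cancel_right, Real.exp_sum]
  refine Finset.prod_congr rfl fun p hp => Real.exp_log ?_
  have hq := rpow_neg_div_log_mem_Icc hν hz hp
  exact (Real.exp_pos (-ν)).trans_le (le_one_sub_mul_one_sub
    (extremalProb_le_one κ p) hq.2 hq.1)

/-! ### Euler's constant and the exponential integral at infinity -/

theorem integral_log_mul_exp_neg :
    ∫ t in Set.Ioi (0 : ℝ), Real.log t * Real.exp (-t) = -Real.eulerMascheroniConstant := by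
  have h1 := Complex.hasDerivAt_GammaIntegral (s := 1) (by simp)
  have h2 : Complex.GammaIntegral =ᶠ[𝓝 1] Complex.Gamma := by
    have : ∀ᶠ s : ℂ in 𝓝 1, 0 < s.re :=
      Complex.continuous_re.continuousAt.eventually (lt_mem_nhds (by simp))
    filter_upwards [this] with s hs
    exact (Complex.Gamma_eq_integral hs).symm
  have h3 := (h1.congr_of_eventuallyEq h2.symm).unique Complex.hasDerivAt_Gamma_one
  simp only [sub_self, Complex.cpow_zero, one_mul] at h3
  have h4 : ∫ t in Set.Ioi (0 : ℝ), ((Real.log t : ℂ) * (Real.exp (-t) : ℂ)) =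
      ((∫ t in Set.Ioi (0 : ℝ), Real.log t * Real.exp (-t) : ℝ) : ℂ) := by
    rw [← integral_complex_ofReal]
    simp
  rw [h4] at h3
  exact_mod_cast h3

/-- A non-integrable function has integral 0 by convention, which the value `-γ ≠ 0` excludes. -/
theorem integrableOn_log_mul_exp_neg :
    MeasureTheory.IntegrableOn (fun t : ℝ => Real.log t * Real.exp (-t)) (Set.Ioi 0) := by
  by_contra h
  have h1 := integral_log_mul_exp_neg
  rw [MeasureTheory.integral_undef h] at h1
  linarith [Real.one_half_lt_eulerMascheroniConstant]

/-- Integration by parts with the primitive `1 - e^(-t)` of `e^(-t)`, chosen to vanish at 0 so that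
it cancels the singularity of `log`. -/
theorem integral_log_mul_exp_neg_eq {x : ℝ} (hx : 0 < x) :
    ∫ t in (0 : ℝ)..x, Real.log t * Real.exp (-t) =
      (1 - Real.exp (-x)) * Real.log x - einIntegral x := by
  have hi : IntervalIntegrable (fun t : ℝ => Real.log t * Real.exp (-t)) MeasureTheory.volume 0 x := by
    rw [intervalIntegrable_iff_integrableOn_Ioc_of_le hx.le]
    exact integrableOn_log_mul_exp_neg.mono_set Set.Ioc_subset_Ioi_self
  have hi2 := intervalIntegrable_one_sub_exp_neg_div hx.le
  have hd : ∀ t : ℝ, 0 < t → HasDerivAt (fun t : ℝ => (1 - Real.exp (-t)) * Real.log t)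
      (Real.log t * Real.exp (-t) + (1 - Real.exp (-t)) / t) t := by
    intro t ht
    have h1 : HasDerivAt (fun t : ℝ => 1 - Real.exp (-t)) (Real.exp (-t)) t := by
      have := ((hasDerivAt_neg t).exp).const_sub 1
      simpa using this
    convert! h1.mul (Real.hasDerivAt_log ht.ne') using 1
    ring
  have h0 : Tendsto (fun t : ℝ => (1 - Real.exp (-t)) * Real.log t) (𝓝[>] 0) (𝓝 0) := by
    have h1 : Tendsto (fun t : ℝ => t * Real.log t) (𝓝[>] 0) (𝓝 0) := by
      have := Real.continuous_mul_log.tendsto 0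
      simp only [zero_mul] at this
      exact this.mono_left nhdsWithin_le_nhds
    have h2 := h1.norm
    rw [norm_zero] at h2
    refine squeeze_zero_norm' ?_ h2
    filter_upwards [self_mem_nhdsWithin] with t ht
    have ht' : 0 < t := ht
    rw [norm_mul, norm_mul]
    refine mul_le_mul_of_nonneg_right ?_ (norm_nonneg _)
    rw [Real.norm_of_nonneg (by linarith [Real.exp_le_one_iff.2 (neg_nonpos.2 ht'.le)]),
      Real.norm_of_nonneg ht'.le]
    linarith [Real.add_one_le_exp (-t)]
  have h := intervalIntegral.integral_eq_sub_of_hasDerivAt_of_tendsto hx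
    (fun t ht => hd t ht.1) (hi.add hi2) h0
    ((hd x hx).continuousAt.tendsto.mono_left nhdsWithin_le_nhds)
  rw [intervalIntegral.integral_add hi hi2] at h
  rw [einIntegral]
  linarith

theorem tendsto_einIntegral_sub_log :
    Tendsto (fun x : ℝ => einIntegral x - Real.log x) atTop
      (𝓝 Real.eulerMascheroniConstant) := by
  have h1 : Tendsto (fun x : ℝ => ∫ t in (0 : ℝ)..x, Real.log t * Real.exp (-t)) atTop
      (𝓝 (-Real.eulerMascheroniConstant)) := by
    rw [← integral_log_mul_exp_neg]
    exact MeasureTheory.intervalIntegral_tendsto_integral_Ioi 0 integrableOn_log_mul_exp_neg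
      tendsto_id
  have h2 : Tendsto (fun x : ℝ => Real.exp (-x) * Real.log x) atTop (𝓝 0) := by
    have h3 : Tendsto (fun x : ℝ => x * Real.exp (-x)) atTop (𝓝 0) := by
      simpa using Real.tendsto_pow_mul_exp_neg_atTop_nhds_zero 1
    refine squeeze_zero' ?_ ?_ h3
    · filter_upwards [eventually_ge_atTop 1] with x hx
      exact mul_nonneg (Real.exp_pos _).le (Real.log_nonneg hx)
    · filter_upwards [eventually_ge_atTop 1] with x hx
      rw [mul_comm]
      exact mul_le_mul_of_nonneg_right (Real.log_le_self (by linarith)) (Real.exp_pos _).le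
  have h4 := (h1.neg.sub h2)
  rw [neg_neg, sub_zero] at h4
  refine h4.congr' ?_
  filter_upwards [eventually_gt_atTop 0] with x hx
  rw [integral_log_mul_exp_neg_eq hx]
  ring

theorem hasDerivAt_einIntegral {x : ℝ} (hx : 0 < x) :
    HasDerivAt einIntegral ((1 - Real.exp (-x)) / x) x := by
  refine intervalIntegral.integral_hasDerivAt_right
    (intervalIntegrable_one_sub_exp_neg_div hx.le) ?_ ?_
  · exact (((Real.measurable_exp.comp measurable_neg).const_sub 1).div
      measurable_id).stronglyMeasurable.stronglyMeasurableAtFilter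
  · exact ContinuousAt.div (by fun_prop) continuousAt_id hx.ne'

/-! ### Regularity, positivity and monotonicity of the Ankeny–Onishi function -/

/-- The leading constant `e^(-γκ) / Γ(κ + 1)` of the Ankeny--Onishi function. -/
def selbergConst (κ : ℝ) : ℝ :=
  Real.exp (-Real.eulerMascheroniConstant * κ) / Real.Gamma (κ + 1)

theorem selbergConst_pos {κ : ℝ} (hκ : 0 < κ) : 0 < selbergConst κ :=
  div_pos (Real.exp_pos _) (Real.Gamma_pos_of_pos (by linarith))

theorem continuous_selbergSigmaStep {κ : ℝ} (hκ : 0 < κ) {f : ℝ → ℝ} (hf : Continuous f) :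
    Continuous (selbergSigmaStep κ f) := by
  have h1 : Continuous fun u : ℝ => selbergConst κ * (u / 2) ^ κ :=
    continuous_const.mul ((continuous_id.div_const 2).rpow_const fun _ => Or.inr hκ.le)
  -- Truncating the base at 2 makes the integrand continuous on the whole line; nothing changes for
  -- `u ≥ 2`.
  have h2 : Continuous fun u : ℝ => ∫ t in (2 : ℝ)..u, (max t 2) ^ (-κ - 1) * f (t - 2) := by
    refine intervalIntegral.continuous_primitive (fun a b => Continuous.intervalIntegrable ?_ _ _) 2
    refine Continuous.mul ((continuous_id.max continuous_const).rpow_const fun t => Or.inl ?_)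
      (hf.comp (continuous_id.sub continuous_const))
    exact (lt_of_lt_of_le two_pos (le_max_right _ _)).ne'
  have h3 : ContinuousOn (fun u : ℝ => u ^ κ * (selbergConst κ * (2 : ℝ) ^ (-κ) -
      κ * ∫ t in (2 : ℝ)..u, t ^ (-κ - 1) * f (t - 2))) {u | 2 ≤ u} := by
    have h4 : Continuous fun u : ℝ => u ^ κ * (selbergConst κ * (2 : ℝ) ^ (-κ) -
        κ * ∫ t in (2 : ℝ)..u, (max t 2) ^ (-κ - 1) * f (t - 2)) :=
      (continuous_id.rpow_const fun _ => Or.inr hκ.le).mul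
        (continuous_const.sub (continuous_const.mul h2))
    refine h4.continuousOn.congr fun u hu => ?_
    have hu' : (2 : ℝ) ≤ u := hu
    congr 3
    refine intervalIntegral.integral_congr fun t ht => ?_
    rw [Set.uIcc_of_le hu'] at ht
    simp only [max_eq_left ht.1]
  have h5 : Continuous fun u : ℝ => if u ≤ 2 then selbergConst κ * (u / 2) ^ κ else
      u ^ κ * (selbergConst κ * (2 : ℝ) ^ (-κ) -
        κ * ∫ t in (2 : ℝ)..u, t ^ (-κ - 1) * f (t - 2)) := by
    refine continuous_if_le continuous_id continuous_const h1.continuousOn h3 fun u hu => ?_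
    rw [show u = 2 from hu]
    have : (2 : ℝ) ^ κ * 2 ^ (-κ) = 1 := by
      rw [← Real.rpow_add two_pos, add_neg_cancel, Real.rpow_zero]
    simp
    linear_combination (-selbergConst κ) * this
  refine continuous_if_le continuous_id continuous_const continuousOn_const h5.continuousOn
    fun u hu => ?_
  rw [show u = 0 from hu]
  simp [Real.zero_rpow hκ.ne']

theorem selbergSigma_eq_iterate (κ : ℝ) {u : ℝ} {m : ℕ} (h : u ≤ m) :
    selbergSigma κ u = (selbergSigmaStep κ)^[m] (fun _ => 0) u := by
  refine (selbergSigmaStep_iterate_eq κ ⌈u⌉₊ m (Nat.ceil_le.2 h) u ?_).symm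
  have := Nat.le_ceil u
  have h0 : (0 : ℝ) ≤ (⌈u⌉₊ : ℝ) := Nat.cast_nonneg _
  linarith

theorem continuous_selbergSigma {κ : ℝ} (hκ : 0 < κ) : Continuous (selbergSigma κ) := by
  have hit : ∀ m : ℕ, Continuous ((selbergSigmaStep κ)^[m] fun _ => 0) := by
    intro m
    induction m with
    | zero => exact continuous_const
    | succ m ih =>
      rw [Function.iterate_succ_apply']
      exact continuous_selbergSigmaStep hκ ih
  rw [continuous_iff_continuousAt]
  intro u
  refine (hit ⌈u + 1⌉₊).continuousAt.congr ?_
  filter_upwards [gt_mem_nhds (lt_add_one u)] with v hv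
  exact (selbergSigma_eq_iterate κ (hv.le.trans (Nat.le_ceil _))).symm

/-- The rescaled function `y ↦ σ_κ(2y)`. -/
def selbergCdf (κ y : ℝ) : ℝ := selbergSigma κ (2 * y)

theorem continuous_selbergCdf {κ : ℝ} (hκ : 0 < κ) : Continuous (selbergCdf κ) :=
  (continuous_selbergSigma hκ).comp (continuous_const.mul continuous_id)

theorem selbergCdf_of_nonpos (κ : ℝ) {y : ℝ} (hy : y ≤ 0) : selbergCdf κ y = 0 := by
  rw [selbergCdf, selbergSigma_eq, selbergSigmaStep, if_pos (by linarith)]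

theorem selbergCdf_of_le_one (κ : ℝ) {y : ℝ} (hy : 0 < y) (hy1 : y ≤ 1) :
    selbergCdf κ y = selbergConst κ * y ^ κ := by
  rw [selbergCdf, selbergSigma_eq, selbergSigmaStep, if_neg (by linarith), if_pos (by linarith),
    mul_div_cancel_left₀ _ two_ne_zero, selbergConst]

/-- One formula covers initial range and delay range, because the integrand vanishes for `v ≤ 1`. -/
theorem selbergCdf_eq (κ : ℝ) {y : ℝ} (hy : 0 < y) :
    selbergCdf κ y = y ^ κ * (selbergConst κ -
      κ * ∫ v in (1 : ℝ)..y, v ^ (-κ - 1) * selbergCdf κ (v - 1)) := by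
  rcases le_or_gt y 1 with hy1 | hy1
  · have : ∫ v in (1 : ℝ)..y, v ^ (-κ - 1) * selbergCdf κ (v - 1) = 0 := by
      rw [intervalIntegral.integral_congr (g := fun _ => 0), intervalIntegral.integral_zero]
      intro v hv
      rw [Set.uIcc_of_ge hy1] at hv
      simp only [selbergCdf_of_nonpos κ (show v - 1 ≤ 0 by linarith [hv.2]), mul_zero]
    rw [this, selbergCdf_of_le_one κ hy hy1]
    ring
  · have h2 := intervalIntegral.integral_comp_mul_left (a := 1) (b := y)
      (fun t : ℝ => t ^ (-κ - 1) * selbergSigma κ (t - 2)) (c := 2) two_ne_zero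
    have h3 : ∫ v in (1 : ℝ)..y, (2 * v) ^ (-κ - 1) * selbergSigma κ (2 * v - 2) =
        2 ^ (-κ - 1) * ∫ v in (1 : ℝ)..y, v ^ (-κ - 1) * selbergCdf κ (v - 1) := by
      rw [← intervalIntegral.integral_const_mul]
      refine intervalIntegral.integral_congr fun v hv => ?_
      rw [Set.uIcc_of_le hy1.le] at hv
      rw [Real.mul_rpow two_pos.le (by linarith [hv.1]), selbergCdf, mul_sub, mul_one]
      ring
    rw [h3, smul_eq_mul, mul_one] at h2
    rw [selbergCdf, selbergSigma_eq, selbergSigmaStep, if_neg (by linarith),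
      if_neg (by linarith), Real.mul_rpow two_pos.le hy.le, ← selbergConst]
    have h4 : ∫ t in (2 : ℝ)..2 * y, t ^ (-κ - 1) * selbergSigma κ (t - 2) =
        2 ^ (-κ) * ∫ v in (1 : ℝ)..y, v ^ (-κ - 1) * selbergCdf κ (v - 1) := by
      rw [Real.rpow_sub_one two_ne_zero] at h2
      linear_combination (-2) * h2
    have h5 : (2 : ℝ) ^ κ * 2 ^ (-κ) = 1 := by
      rw [← Real.rpow_add two_pos, add_neg_cancel, Real.rpow_zero]
    rw [h4]
    linear_combination (y ^ κ * (selbergConst κ -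
      κ * ∫ v in (1 : ℝ)..y, v ^ (-κ - 1) * selbergCdf κ (v - 1))) * h5

/-- The derivative `κ (σ_κ(2y) - σ_κ(2y - 2)) / y` of `y ↦ σ_κ(2y)`. -/
def selbergDensity (κ y : ℝ) : ℝ := κ * (selbergCdf κ y - selbergCdf κ (y - 1)) / y

theorem hasDerivAt_selbergCdf {κ : ℝ} (hκ : 0 < κ) {y : ℝ} (hy : 0 < y) :
    HasDerivAt (selbergCdf κ) (selbergDensity κ y) y := by
  have hc : Continuous fun v => selbergCdf κ (v - 1) :=
    (continuous_selbergCdf hκ).comp (continuous_id.sub continuous_const)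
  have hco : ContinuousOn (fun v : ℝ => v ^ (-κ - 1) * selbergCdf κ (v - 1)) (Set.Ioi 0) :=
    (continuousOn_id.rpow_const fun v hv => Or.inl (ne_of_gt hv)).mul hc.continuousOn
  have hI : HasDerivAt (fun y => ∫ v in (1 : ℝ)..y, v ^ (-κ - 1) * selbergCdf κ (v - 1))
      (y ^ (-κ - 1) * selbergCdf κ (y - 1)) y := by
    refine intervalIntegral.integral_hasDerivAt_right ?_ ?_ ?_
    · refine (hco.mono fun v hv => ?_).intervalIntegrable
      exact (lt_min one_pos hy).trans_le hv.1
    · exact hco.stronglyMeasurableAtFilter isOpen_Ioi y hy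
    · exact hco.continuousAt (Ioi_mem_nhds hy)
  have h1 := (Real.hasDerivAt_rpow_const (p := κ) (Or.inl hy.ne')).mul
    ((hI.const_mul κ).const_sub (selbergConst κ))
  have h2 : selbergCdf κ =ᶠ[𝓝 y] ((fun x : ℝ => x ^ κ) * fun x => selbergConst κ -
      κ * ∫ v in (1 : ℝ)..x, v ^ (-κ - 1) * selbergCdf κ (v - 1)) := by
    filter_upwards [Ioi_mem_nhds hy] with x hx
    exact selbergCdf_eq κ hx
  refine (h1.congr_of_eventuallyEq h2).congr_deriv ?_
  have h3 := selbergCdf_eq κ hy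
  have h4 : y ^ κ * y ^ (-κ - 1) = y⁻¹ := by
    rw [← Real.rpow_add hy, ← Real.rpow_neg_one]
    congr 1
    ring
  rw [selbergDensity, Real.rpow_sub_one hy.ne', h3]
  linear_combination (-κ * selbergCdf κ (y - 1)) * h4

/-- First-failure argument. The derivative has the sign of `selbergCdf κ y - selbergCdf κ (y - 1)`.
Before the first point `w` of failure it is positive, so the function increases strictly on `[0,
w]`, which contradicts failure at `w`. -/
theorem selbergCdf_sub_one_lt {κ : ℝ} (hκ : 0 < κ) {y : ℝ} (hy : 0 < y) :
    selbergCdf κ (y - 1) < selbergCdf κ y := by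
  by_contra hcon
  set Z : Set ℝ := {x | 1 ≤ x ∧ selbergCdf κ x ≤ selbergCdf κ (x - 1)} with hZ
  have hle1 : ∀ x, 0 < x → x ≤ 1 → selbergCdf κ (x - 1) < selbergCdf κ x := by
    intro x hx hx1
    rw [selbergCdf_of_nonpos κ (by linarith), selbergCdf_of_le_one κ hx hx1]
    exact mul_pos (selbergConst_pos hκ) (Real.rpow_pos_of_pos hx κ)
  have hyZ : y ∈ Z := by
    refine ⟨?_, not_lt.1 hcon⟩
    by_contra h
    exact hcon (hle1 y hy (not_le.1 h).le)
  have hZc : IsClosed Z := by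
    refine (isClosed_le continuous_const continuous_id).inter
      (isClosed_le (continuous_selbergCdf hκ) ?_)
    exact (continuous_selbergCdf hκ).comp (continuous_id.sub continuous_const)
  have hZb : BddBelow Z := ⟨1, fun x hx => hx.1⟩
  obtain ⟨h1, h2⟩ := hZc.csInf_mem ⟨y, hyZ⟩ hZb
  set w := sInf Z with hw
  have hlt : ∀ x, 0 < x → x < w → selbergCdf κ (x - 1) < selbergCdf κ x := by
    intro x hx hxw
    by_contra h
    rcases le_or_gt x 1 with hx1 | hx1
    · exact h (hle1 x hx hx1)
    · exact absurd (csInf_le hZb ⟨hx1.le, not_lt.1 h⟩) (not_le.2 hxw)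
  have hmono : StrictMonoOn (selbergCdf κ) (Set.Icc 0 w) := by
    refine strictMonoOn_of_deriv_pos (convex_Icc 0 w) (continuous_selbergCdf hκ).continuousOn ?_
    intro x hx
    rw [interior_Icc] at hx
    rw [(hasDerivAt_selbergCdf hκ hx.1).deriv]
    exact div_pos (mul_pos hκ (sub_pos.2 (hlt x hx.1 hx.2))) hx.1
  exact absurd h2 (not_le.2 (hmono ⟨by linarith, by linarith⟩ ⟨by linarith, le_rfl⟩ (by linarith)))

theorem strictMonoOn_selbergCdf {κ : ℝ} (hκ : 0 < κ) :
    StrictMonoOn (selbergCdf κ) (Set.Ici 0) := by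
  refine strictMonoOn_of_deriv_pos (convex_Ici 0) (continuous_selbergCdf hκ).continuousOn ?_
  intro x hx
  rw [interior_Ici] at hx
  rw [(hasDerivAt_selbergCdf hκ hx).deriv]
  exact div_pos (mul_pos hκ (sub_pos.2 (selbergCdf_sub_one_lt hκ hx))) hx

theorem selbergCdf_pos {κ : ℝ} (hκ : 0 < κ) {y : ℝ} (hy : 0 < y) : 0 < selbergCdf κ y := by
  have h := strictMonoOn_selbergCdf hκ Set.self_mem_Ici hy.le hy
  rwa [selbergCdf_of_nonpos κ le_rfl] at h

theorem selbergCdf_nonneg {κ : ℝ} (hκ : 0 < κ) (y : ℝ) : 0 ≤ selbergCdf κ y := by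
  rcases le_or_gt y 0 with h | h
  · rw [selbergCdf_of_nonpos κ h]
  · exact (selbergCdf_pos hκ h).le

theorem selbergCdf_le {κ : ℝ} (hκ : 0 < κ) {y : ℝ} (hy : 0 < y) :
    selbergCdf κ y ≤ selbergConst κ * y ^ κ := by
  rcases le_or_gt y 1 with hy1 | hy1
  · exact (selbergCdf_of_le_one κ hy hy1).le
  · rw [selbergCdf_eq κ hy, mul_comm]
    refine mul_le_mul_of_nonneg_right ?_ (Real.rpow_nonneg hy.le κ)
    have : 0 ≤ ∫ v in (1 : ℝ)..y, v ^ (-κ - 1) * selbergCdf κ (v - 1) :=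
      intervalIntegral.integral_nonneg hy1.le fun v hv =>
        mul_nonneg (Real.rpow_nonneg (by linarith [hv.1]) _) (selbergCdf_nonneg hκ _)
    linarith [mul_nonneg hκ.le this]

theorem selbergDensity_nonneg {κ : ℝ} (hκ : 0 < κ) {y : ℝ} (hy : 0 < y) :
    0 ≤ selbergDensity κ y :=
  div_nonneg (mul_nonneg hκ.le (sub_pos.2 (selbergCdf_sub_one_lt hκ hy)).le) hy.le

theorem selbergDensity_le {κ : ℝ} (hκ : 0 < κ) {y : ℝ} (hy : 0 < y) :
    selbergDensity κ y ≤ κ * selbergConst κ * y ^ (κ - 1) := by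
  rw [selbergDensity, Real.rpow_sub_one hy.ne', ← mul_div_assoc, mul_assoc]
  refine div_le_div_of_nonneg_right (mul_le_mul_of_nonneg_left ?_ hκ.le) hy.le
  linarith [selbergCdf_nonneg hκ (y - 1), selbergCdf_le hκ hy]

theorem continuousOn_selbergDensity {κ : ℝ} (hκ : 0 < κ) :
    ContinuousOn (selbergDensity κ) (Set.Ioi 0) := by
  have h := continuous_selbergCdf hκ
  refine ContinuousOn.div (Continuous.continuousOn ?_) continuousOn_id fun y hy => ne_of_gt hy
  exact continuous_const.mul (h.sub (h.comp (continuous_id.sub continuous_const)))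

/-! ### Laplace transform of the Ankeny–Onishi density -/

open MeasureTheory Set in
theorem integrableOn_rpow_mul_exp_neg_mul {s b : ℝ} (hs : -1 < s) (hb : 0 < b) :
    IntegrableOn (fun y : ℝ => y ^ s * Real.exp (-(b * y))) (Ioi 0) := by
  simpa using integrableOn_rpow_mul_exp_neg_mul_rpow (p := 1) hs one_pos hb

open MeasureTheory Set in
theorem integrableOn_exp_mul_selbergCdf {κ b : ℝ} (hκ : 0 < κ) (hb : 0 < b) :
    IntegrableOn (fun y => Real.exp (-(b * y)) * selbergCdf κ y) (Ioi 0) := by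
  refine Integrable.mono' ((integrableOn_rpow_mul_exp_neg_mul (s := κ) (by linarith) hb).const_mul
    (selbergConst κ)) (Continuous.aestronglyMeasurable ?_) ?_
  · exact (by fun_prop : Continuous fun y : ℝ => Real.exp (-(b * y))).mul (continuous_selbergCdf hκ)
  · refine (ae_restrict_iff' measurableSet_Ioi).2 (Eventually.of_forall fun y hy => ?_)
    rw [Real.norm_of_nonneg (mul_nonneg (Real.exp_pos _).le (selbergCdf_nonneg hκ y))]
    have := mul_le_mul_of_nonneg_left (selbergCdf_le hκ hy) (Real.exp_pos (-(b * y))).le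
    linarith

open MeasureTheory Set in
theorem integrableOn_exp_mul_selbergDensity {κ b : ℝ} (hκ : 0 < κ) (hb : 0 < b) :
    IntegrableOn (fun y => Real.exp (-(b * y)) * selbergDensity κ y) (Ioi 0) := by
  refine Integrable.mono' ((integrableOn_rpow_mul_exp_neg_mul (s := κ - 1) (by linarith) hb).const_mul
    (κ * selbergConst κ)) (ContinuousOn.aestronglyMeasurable ?_ measurableSet_Ioi) ?_
  · exact (by fun_prop : Continuous fun y : ℝ => Real.exp (-(b * y))).continuousOn.mul
      (continuousOn_selbergDensity hκ)
  · refine (ae_restrict_iff' measurableSet_Ioi).2 (Eventually.of_forall fun y hy => ?_)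
    rw [Real.norm_of_nonneg (mul_nonneg (Real.exp_pos _).le (selbergDensity_nonneg hκ hy))]
    have := mul_le_mul_of_nonneg_left (selbergDensity_le hκ hy) (Real.exp_pos (-(b * y))).le
    linarith

/-- The Laplace transform of `selbergDensity κ`. -/
def selbergLaplace (κ b : ℝ) : ℝ := ∫ y in Set.Ioi (0 : ℝ), Real.exp (-(b * y)) * selbergDensity κ y

open MeasureTheory Set in
theorem selbergLaplace_eq {κ b : ℝ} (hκ : 0 < κ) (hb : 0 < b) :
    selbergLaplace κ b = b * ∫ y in Ioi (0 : ℝ), Real.exp (-(b * y)) * selbergCdf κ y := by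
  have hd : ∀ y : ℝ, HasDerivAt (fun y : ℝ => Real.exp (-(b * y))) (-b * Real.exp (-(b * y))) y := by
    intro y
    have h := (((hasDerivAt_id y).const_mul b).neg).exp
    convert! h using 1
    simp
    ring
  have h0 : Tendsto ((fun y : ℝ => Real.exp (-(b * y))) * selbergCdf κ) (𝓝[>] 0) (𝓝 0) := by
    have hc : Continuous ((fun y : ℝ => Real.exp (-(b * y))) * selbergCdf κ) :=
      (by fun_prop : Continuous fun y : ℝ => Real.exp (-(b * y))).mul (continuous_selbergCdf hκ)
    have := hc.tendsto 0
    simp only [Pi.mul_apply, selbergCdf_of_nonpos κ le_rfl, mul_zero] at this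
    exact this.mono_left nhdsWithin_le_nhds
  have hinf : Tendsto ((fun y : ℝ => Real.exp (-(b * y))) * selbergCdf κ) atTop (𝓝 0) := by
    have h1 := (tendsto_rpow_mul_exp_neg_mul_atTop_nhds_zero κ b hb).const_mul (selbergConst κ)
    rw [mul_zero] at h1
    refine squeeze_zero' (Eventually.of_forall fun y =>
      mul_nonneg (Real.exp_pos _).le (selbergCdf_nonneg hκ y)) ?_ h1
    filter_upwards [eventually_gt_atTop 0] with y hy
    have := mul_le_mul_of_nonneg_left (selbergCdf_le hκ hy) (Real.exp_pos (-(b * y))).le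
    simp only [Pi.mul_apply]
    rw [neg_mul]
    linarith
  have h := integral_Ioi_mul_deriv_eq_deriv_mul (fun y _ => hd y)
    (fun y hy => hasDerivAt_selbergCdf hκ hy) (integrableOn_exp_mul_selbergDensity hκ hb)
    (by
      refine ((integrableOn_exp_mul_selbergCdf hκ hb).const_mul (-b)).congr
        (Eventually.of_forall fun y => ?_)
      simp only [Pi.mul_apply]
      ring) h0 hinf
  rw [selbergLaplace, h, ← integral_const_mul, sub_zero, zero_sub, ← integral_neg]
  refine integral_congr_ae (Eventually.of_forall fun y => ?_)
  simp only
  ring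

-- Translation by 1; the piece over `(-1, 0]` does not contribute because `selbergCdf` vanishes
-- there.
open MeasureTheory Set in
theorem integral_exp_mul_selbergCdf_sub_one {κ b : ℝ} :
    ∫ y in Ioi (0 : ℝ), Real.exp (-(b * y)) * selbergCdf κ (y - 1) =
      Real.exp (-b) * ∫ y in Ioi (0 : ℝ), Real.exp (-(b * y)) * selbergCdf κ y := by
  have hind : ∀ a : ℝ, a ≤ 0 → ∫ y in Ioi a, Real.exp (-(b * y)) * selbergCdf κ y =
      ∫ y in Ioi (0 : ℝ), Real.exp (-(b * y)) * selbergCdf κ y := by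
    intro a ha
    refine setIntegral_eq_of_subset_of_forall_sdiff_eq_zero measurableSet_Ioi
      (Ioi_subset_Ioi ha) fun y hy => ?_
    rw [selbergCdf_of_nonpos κ (not_lt.1 hy.2), mul_zero]
  rw [← hind (-1) (by norm_num), ← integral_const_mul]
  have h := (measurePreserving_sub_right volume (1 : ℝ)).setIntegral_preimage_emb
    (measurableEmbedding_subRight 1)
    (fun y => Real.exp (-b) * (Real.exp (-(b * y)) * selbergCdf κ y)) (Ioi (-1))
  rw [← h]
  have h2 : (fun x : ℝ => x - 1) ⁻¹' Ioi (-1) = Ioi 0 := by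
    ext x
    simp
  rw [h2]
  refine integral_congr_ae (Eventually.of_forall fun y => ?_)
  simp only
  rw [← mul_assoc, ← Real.exp_add]
  congr 2
  ring

open MeasureTheory Set in
theorem integrableOn_exp_mul_selbergCdf_sub_one {κ b : ℝ} (hκ : 0 < κ) (hb : 0 < b) :
    IntegrableOn (fun y => Real.exp (-(b * y)) * selbergCdf κ (y - 1)) (Ioi 0) := by
  refine Integrable.mono' (integrableOn_exp_mul_selbergCdf hκ hb)
    (Continuous.aestronglyMeasurable ?_) ?_
  · exact (by fun_prop : Continuous fun y : ℝ => Real.exp (-(b * y))).mul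
      ((continuous_selbergCdf hκ).comp (continuous_id.sub continuous_const))
  · refine (ae_restrict_iff' measurableSet_Ioi).2 (Eventually.of_forall fun y hy => ?_)
    rw [Real.norm_of_nonneg (mul_nonneg (Real.exp_pos _).le (selbergCdf_nonneg hκ _))]
    exact mul_le_mul_of_nonneg_left (selbergCdf_sub_one_lt hκ hy).le (Real.exp_pos _).le

-- Differentiation under the integral brings down `-y`, and `y * selbergDensity κ y` is `κ` times a
-- unit difference of `selbergCdf`. The shift becomes the factor `e^(-b)`, so the delay equation
-- turns into an ordinary one.
open MeasureTheory Set in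
theorem hasDerivAt_selbergLaplace {κ b : ℝ} (hκ : 0 < κ) (hb : 0 < b) :
    HasDerivAt (selbergLaplace κ) (-(κ * ((1 - Real.exp (-b)) / b) * selbergLaplace κ b)) b := by
  have hmeas : ∀ c : ℝ, AEStronglyMeasurable (fun y => Real.exp (-(c * y)) * selbergDensity κ y)
      (volume.restrict (Ioi 0)) := fun c =>
    ((by fun_prop : Continuous fun y : ℝ => Real.exp (-(c * y))).continuousOn.mul
      (continuousOn_selbergDensity hκ)).aestronglyMeasurable measurableSet_Ioi
  have h := hasDerivAt_integral_of_dominated_loc_of_deriv_le (μ := volume.restrict (Ioi (0 : ℝ)))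
    (s := Ioi (b / 2)) (x₀ := b) (F := fun c y => Real.exp (-(c * y)) * selbergDensity κ y)
    (F' := fun c y => -y * (Real.exp (-(c * y)) * selbergDensity κ y))
    (bound := fun y => κ * selbergConst κ * (y ^ κ * Real.exp (-(b / 2 * y))))
    (Ioi_mem_nhds (by linarith)) (Eventually.of_forall hmeas)
    (integrableOn_exp_mul_selbergDensity hκ hb)
    (continuous_neg.aestronglyMeasurable.mul (hmeas b))
    (by
      refine (ae_restrict_iff' measurableSet_Ioi).2 (Eventually.of_forall fun y hy c hc => ?_)
      have hy0 : (0 : ℝ) < y := hy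
      have hc' : b / 2 < c := hc
      rw [norm_mul, norm_neg, Real.norm_of_nonneg hy0.le, Real.norm_of_nonneg
        (mul_nonneg (Real.exp_pos _).le (selbergDensity_nonneg hκ hy))]
      have h1 : Real.exp (-(c * y)) ≤ Real.exp (-(b / 2 * y)) :=
        Real.exp_le_exp.2 (neg_le_neg (mul_le_mul_of_nonneg_right hc'.le hy0.le))
      have h2 := mul_le_mul h1 (selbergDensity_le hκ hy) (selbergDensity_nonneg hκ hy)
        (Real.exp_pos _).le
      have h3 : y * y ^ (κ - 1) = y ^ κ := by
        rw [Real.rpow_sub_one hy0.ne']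
        field_simp
      calc y * (Real.exp (-(c * y)) * selbergDensity κ y)
          ≤ y * (Real.exp (-(b / 2 * y)) * (κ * selbergConst κ * y ^ (κ - 1))) :=
            mul_le_mul_of_nonneg_left h2 hy0.le
        _ = _ := by rw [← h3]; ring)
    ((integrableOn_rpow_mul_exp_neg_mul (by linarith) (by linarith)).const_mul _)
    (Eventually.of_forall fun y c _ => by
      have h1 : HasDerivAt (fun c : ℝ => -(c * y)) (-y) c := by
        convert! ((hasDerivAt_id c).mul_const y).neg using 1
        simp
      convert! h1.exp.mul_const (selbergDensity κ y) using 1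
      ring)
  refine h.2.congr_deriv ?_
  have h1 : ∫ y in Ioi (0 : ℝ), -y * (Real.exp (-(b * y)) * selbergDensity κ y) =
      ∫ y in Ioi (0 : ℝ), -κ * (Real.exp (-(b * y)) * selbergCdf κ y -
        Real.exp (-(b * y)) * selbergCdf κ (y - 1)) := by
    refine setIntegral_congr_fun measurableSet_Ioi fun y hy => ?_
    have hy0 : (0 : ℝ) < y := hy
    simp only [selbergDensity]
    field_simp
  rw [h1, integral_const_mul, integral_sub (integrableOn_exp_mul_selbergCdf hκ hb)
    (integrableOn_exp_mul_selbergCdf_sub_one hκ hb), integral_exp_mul_selbergCdf_sub_one,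
    selbergLaplace_eq hκ hb]
  field_simp

-- After the substitution `x = b y`, large `b` sees only the initial range, where `selbergCdf` is
-- `selbergConst κ * y ^ κ`. The Gamma integral that appears cancels the denominator of
-- `selbergConst`.
open MeasureTheory Set in
theorem tendsto_rpow_mul_selbergLaplace {κ : ℝ} (hκ : 0 < κ) :
    Tendsto (fun b => b ^ κ * selbergLaplace κ b) atTop
      (𝓝 (Real.exp (-Real.eulerMascheroniConstant * κ))) := by
  have hint : ∫ x in Ioi (0 : ℝ), Real.exp (-x) * (selbergConst κ * x ^ κ) =
      Real.exp (-Real.eulerMascheroniConstant * κ) := by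
    have h1 := Real.Gamma_eq_integral (s := κ + 1) (by linarith)
    rw [add_sub_cancel_right] at h1
    have h2 : Real.Gamma (κ + 1) ≠ 0 := (Real.Gamma_pos_of_pos (by linarith)).ne'
    have h3 : ∫ x in Ioi (0 : ℝ), Real.exp (-x) * (selbergConst κ * x ^ κ) =
        selbergConst κ * ∫ x in Ioi (0 : ℝ), Real.exp (-x) * x ^ κ := by
      rw [← integral_const_mul]
      refine integral_congr_ae (Eventually.of_forall fun x => ?_)
      simp only
      ring
    rw [h3, ← h1, selbergConst, div_mul_cancel₀ _ h2]
  have hdct : Tendsto (fun b : ℝ => ∫ x in Ioi (0 : ℝ),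
      Real.exp (-x) * (b ^ κ * selbergCdf κ (x / b))) atTop
      (𝓝 (∫ x in Ioi (0 : ℝ), Real.exp (-x) * (selbergConst κ * x ^ κ))) := by
    refine tendsto_integral_filter_of_dominated_convergence
      (fun x => selbergConst κ * (x ^ κ * Real.exp (-(1 * x)))) ?_ ?_
      ((integrableOn_rpow_mul_exp_neg_mul (by linarith) one_pos).const_mul _) ?_
    · refine Eventually.of_forall fun b => Continuous.aestronglyMeasurable ?_
      exact (by fun_prop : Continuous fun x : ℝ => Real.exp (-x)).mul
        (continuous_const.mul ((continuous_selbergCdf hκ).comp (continuous_id.div_const b)))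
    · filter_upwards [eventually_gt_atTop 0] with b hb
      refine (ae_restrict_iff' measurableSet_Ioi).2 (Eventually.of_forall fun x hx => ?_)
      have hx0 : (0 : ℝ) < x := hx
      have h1 := selbergCdf_le hκ (div_pos hx0 hb)
      have hbk := Real.rpow_pos_of_pos hb κ
      rw [Real.norm_of_nonneg (mul_nonneg (Real.exp_pos _).le
        (mul_nonneg hbk.le (selbergCdf_nonneg hκ _))), one_mul]
      have h2 : b ^ κ * selbergCdf κ (x / b) ≤ selbergConst κ * x ^ κ := by
        calc _ ≤ b ^ κ * (selbergConst κ * (x / b) ^ κ) := mul_le_mul_of_nonneg_left h1 hbk.le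
          _ = _ := by
            rw [Real.div_rpow hx0.le hb.le]
            field_simp
      have := mul_le_mul_of_nonneg_left h2 (Real.exp_pos (-x)).le
      linarith
    · refine (ae_restrict_iff' measurableSet_Ioi).2 (Eventually.of_forall fun x hx => ?_)
      have hx0 : (0 : ℝ) < x := hx
      refine tendsto_const_nhds.congr' ?_
      filter_upwards [eventually_ge_atTop x, eventually_gt_atTop 0] with b hbx hb
      have hbk := Real.rpow_pos_of_pos hb κ
      rw [selbergCdf_of_le_one κ (div_pos hx0 hb) ((div_le_one hb).2 hbx),
        Real.div_rpow hx0.le hb.le]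
      field_simp
  rw [hint] at hdct
  refine hdct.congr' ?_
  filter_upwards [eventually_gt_atTop 0] with b hb
  rw [selbergLaplace_eq hκ hb]
  have h := integral_comp_mul_left_Ioi
    (fun x : ℝ => Real.exp (-x) * (b ^ κ * selbergCdf κ (x / b))) 0 hb
  rw [mul_zero, smul_eq_mul] at h
  have h2 : ∫ y in Ioi (0 : ℝ), Real.exp (-(b * y)) * (b ^ κ * selbergCdf κ (b * y / b)) =
      b ^ κ * ∫ y in Ioi (0 : ℝ), Real.exp (-(b * y)) * selbergCdf κ y := by
    rw [← integral_const_mul]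
    refine integral_congr_ae (Eventually.of_forall fun y => ?_)
    simp only [mul_div_cancel_left₀ y hb.ne']
    ring
  rw [h2] at h
  have h3 : ∫ x in Ioi (0 : ℝ), Real.exp (-x) * (b ^ κ * selbergCdf κ (x / b)) =
      b * (b⁻¹ * ∫ x in Ioi (0 : ℝ), Real.exp (-x) * (b ^ κ * selbergCdf κ (x / b))) := by
    rw [mul_inv_cancel_left₀ hb.ne']
  rw [h3, ← h]
  ring

/-- The product of the transform with `exp(κ Ein)` has derivative 0. Its constant value is read off
at infinity, where `e^(-γκ)` from `b^κ selbergLaplace κ b` meets `e^(γκ)` from `Ein(b) - log b → γ`.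
-/
theorem selbergLaplace_eq_exp {κ b : ℝ} (hκ : 0 < κ) (hb : 0 < b) :
    selbergLaplace κ b = Real.exp (-(κ * einIntegral b)) := by
  set P : ℝ → ℝ := fun x => selbergLaplace κ x * Real.exp (κ * einIntegral x) with hP
  have hd : ∀ x, 0 < x → HasDerivAt P 0 x := by
    intro x hx
    have h := (hasDerivAt_selbergLaplace hκ hx).mul ((hasDerivAt_einIntegral hx).const_mul κ).exp
    convert! h using 1
    ring
  have hconst : ∀ x, b ≤ x → P x = P b := by
    intro x hx
    have h := constant_of_has_deriv_right_zero (f := P) (a := b) (b := x)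
      (fun y hy => (hd y (hb.trans_le hy.1)).continuousAt.continuousWithinAt)
      (fun y hy => (hd y (hb.trans_le hy.1)).hasDerivWithinAt)
    exact h x ⟨hx, le_rfl⟩
  have hlim : Tendsto P atTop (𝓝 1) := by
    have h1 := (tendsto_rpow_mul_selbergLaplace hκ).mul
      ((tendsto_einIntegral_sub_log.const_mul κ).rexp)
    rw [← Real.exp_add, show -Real.eulerMascheroniConstant * κ +
      κ * Real.eulerMascheroniConstant = 0 by ring, Real.exp_zero] at h1
    refine h1.congr' ?_
    filter_upwards [eventually_gt_atTop 0] with x hx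
    rw [Real.rpow_def_of_pos hx, mul_right_comm, ← Real.exp_add, mul_comm (Real.exp _)]
    congr 2
    ring
  have h1 : P b = 1 := by
    refine tendsto_nhds_unique ?_ hlim
    refine tendsto_const_nhds.congr' ?_
    filter_upwards [eventually_ge_atTop b] with x hx
    exact (hconst x hx).symm
  rw [Real.exp_neg]
  exact eq_inv_of_mul_eq_one_left h1

/-! ### Random subsets with independent inclusions, and monotonicity -/

/-- The probability that the random subset of `P` containing each `p ∈ P` independently with
probability `a p` is equal to `T`. -/
def bernoulliWeight (a : ℕ → ℝ) (P T : Finset ℕ) : ℝ :=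
  (∏ p ∈ T, a p) * ∏ p ∈ P \ T, (1 - a p)

/-- The expectation of `f` at the random subset of `P` described by `bernoulliWeight a P`. -/
def bernoulliExpect (a : ℕ → ℝ) (P : Finset ℕ) (f : Finset ℕ → ℝ) : ℝ :=
  ∑ T ∈ P.powerset, bernoulliWeight a P T * f T

theorem bernoulliWeight_nonneg {a : ℕ → ℝ} {P T : Finset ℕ} (ha0 : ∀ p ∈ P, 0 ≤ a p)
    (ha1 : ∀ p ∈ P, a p ≤ 1) (hT : T ⊆ P) : 0 ≤ bernoulliWeight a P T :=
  mul_nonneg (Finset.prod_nonneg fun p hp => ha0 p (hT hp))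
    (Finset.prod_nonneg fun p hp => sub_nonneg.2 (ha1 p (Finset.mem_sdiff.1 hp).1))

theorem bernoulliExpect_mono {a : ℕ → ℝ} {P : Finset ℕ} {f g : Finset ℕ → ℝ}
    (ha0 : ∀ p ∈ P, 0 ≤ a p) (ha1 : ∀ p ∈ P, a p ≤ 1) (hfg : ∀ T ⊆ P, f T ≤ g T) :
    bernoulliExpect a P f ≤ bernoulliExpect a P g :=
  Finset.sum_le_sum fun T hT => mul_le_mul_of_nonneg_left (hfg T (Finset.mem_powerset.1 hT))
    (bernoulliWeight_nonneg ha0 ha1 (Finset.mem_powerset.1 hT))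

theorem bernoulliExpect_prod_ite (a u v : ℕ → ℝ) (P : Finset ℕ) :
    bernoulliExpect a P (fun T => ∏ p ∈ P, if p ∈ T then u p else v p) =
      ∏ p ∈ P, (a p * u p + (1 - a p) * v p) := by
  rw [Finset.prod_add]
  refine Finset.sum_congr rfl fun T hT => ?_
  have h1 : ∏ p ∈ P, (if p ∈ T then u p else v p) = (∏ p ∈ T, u p) * ∏ p ∈ P \ T, v p := by
    rw [← Finset.prod_sdiff (Finset.mem_powerset.1 hT), mul_comm]
    congr 1
    · exact Finset.prod_congr rfl fun p hp => if_pos hp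
    · exact Finset.prod_congr rfl fun p hp => if_neg (Finset.mem_sdiff.1 hp).2
  beta_reduce
  rw [h1, bernoulliWeight, Finset.prod_mul_distrib, Finset.prod_mul_distrib]
  ring

theorem bernoulliExpect_prod (a c : ℕ → ℝ) (P : Finset ℕ) :
    bernoulliExpect a P (fun T => ∏ p ∈ T, c p) = ∏ p ∈ P, (1 - a p * (1 - c p)) := by
  have h := bernoulliExpect_prod_ite a c (fun _ => 1) P
  rw [bernoulliExpect] at h ⊢
  rw [show ∏ p ∈ P, (1 - a p * (1 - c p)) = ∏ p ∈ P, (a p * c p + (1 - a p) * 1) from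
    Finset.prod_congr rfl fun p _ => by ring, ← h]
  refine Finset.sum_congr rfl fun T hT => ?_
  rw [Finset.prod_ite_mem, Finset.inter_eq_right.2 (Finset.mem_powerset.1 hT)]

theorem bernoulliExpect_insert (a : ℕ → ℝ) {P : Finset ℕ} {q : ℕ} (hq : q ∉ P)
    (f : Finset ℕ → ℝ) :
    bernoulliExpect a (insert q P) f = (1 - a q) * bernoulliExpect a P f +
      a q * bernoulliExpect a P fun T => f (insert q T) := by
  rw [bernoulliExpect, Finset.sum_powerset_insert hq, bernoulliExpect, bernoulliExpect,
    Finset.mul_sum, Finset.mul_sum]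
  congr 1
  · refine Finset.sum_congr rfl fun T hT => ?_
    have hqT : q ∉ T := fun h => hq (Finset.mem_powerset.1 hT h)
    rw [bernoulliWeight, bernoulliWeight, Finset.insert_sdiff_of_notMem _ hqT,
      Finset.prod_insert fun h => hq (Finset.mem_sdiff.1 h).1]
    ring
  · refine Finset.sum_congr rfl fun T hT => ?_
    have hqT : q ∉ T := fun h => hq (Finset.mem_powerset.1 hT h)
    have hs : insert q P \ insert q T = P \ T := by
      ext p
      simp only [Finset.mem_sdiff, Finset.mem_insert]
      refine ⟨fun h => ⟨?_, fun h' => h.2 (Or.inr h')⟩, fun h => ⟨Or.inr h.1, ?_⟩⟩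
      · exact h.1.resolve_left fun h' => h.2 (Or.inl h')
      · rintro (rfl | h')
        · exact hq h.1
        · exact h.2 h'
    rw [bernoulliWeight, bernoulliWeight, hs, Finset.prod_insert hqT]
    ring

/-- Increasing the inclusion probabilities decreases the expectation of an antitone function. -/
theorem bernoulliExpect_anti_prob {a b : ℕ → ℝ} {P : Finset ℕ} (ha0 : ∀ p ∈ P, 0 ≤ a p)
    (hab : ∀ p ∈ P, a p ≤ b p) (hb1 : ∀ p ∈ P, b p ≤ 1) {f : Finset ℕ → ℝ} (hf : Antitone f) :
    bernoulliExpect b P f ≤ bernoulliExpect a P f := by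
  induction P using Finset.induction generalizing f with
  | empty => simp [bernoulliExpect, bernoulliWeight]
  | insert q P hq ih =>
    have ha0' : ∀ p ∈ P, 0 ≤ a p := fun p hp => ha0 p (Finset.mem_insert_of_mem hp)
    have hab' : ∀ p ∈ P, a p ≤ b p := fun p hp => hab p (Finset.mem_insert_of_mem hp)
    have hb1' : ∀ p ∈ P, b p ≤ 1 := fun p hp => hb1 p (Finset.mem_insert_of_mem hp)
    have hq0 := ha0 q (Finset.mem_insert_self q P)
    have hqab := hab q (Finset.mem_insert_self q P)
    have hq1 := hb1 q (Finset.mem_insert_self q P)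
    rw [bernoulliExpect_insert b hq, bernoulliExpect_insert a hq]
    have h1 := ih ha0' hab' hb1' hf
    have h2 := ih ha0' hab' hb1' (f := fun T => f (insert q T))
      fun S T hST => hf (Finset.insert_subset_insert q hST)
    have h3 : bernoulliExpect a P (fun T => f (insert q T)) ≤ bernoulliExpect a P f :=
      bernoulliExpect_mono ha0' (fun p hp => (hab' p hp).trans (hb1' p hp))
        fun T _ => hf (Finset.subset_insert q T)
    -- Conditioning on `q`: `h1` and `h2` replace `b` by `a` on `P` with the weights of `b q` kept;
    -- moving the mass `b q - a q` back to the larger conditional expectation is `h3`.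
    nlinarith [mul_le_mul_of_nonneg_left h1 (sub_nonneg.2 hq1),
      mul_le_mul_of_nonneg_left h2 (hq0.trans hqab),
      mul_le_mul_of_nonneg_left h3 (sub_nonneg.2 hqab)]

/-- Enlarging the ground set decreases the expectation of an antitone function. -/
theorem bernoulliExpect_anti_subset {a : ℕ → ℝ} {P Q : Finset ℕ} (hPQ : P ⊆ Q)
    (ha0 : ∀ p ∈ Q, 0 ≤ a p) (ha1 : ∀ p ∈ Q, a p ≤ 1) {f : Finset ℕ → ℝ} (hf : Antitone f) :
    bernoulliExpect a Q f ≤ bernoulliExpect a P f := by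
  suffices h : ∀ U : Finset ℕ, U ⊆ Q → Disjoint U P →
      bernoulliExpect a (U ∪ P) f ≤ bernoulliExpect a P f by
    have := h (Q \ P) Finset.sdiff_subset Finset.sdiff_disjoint
    rwa [Finset.sdiff_union_of_subset hPQ] at this
  intro U
  induction U using Finset.induction with
  | empty => simp
  | insert q U hq ih =>
    intro hUQ hd
    rw [Finset.disjoint_insert_left] at hd
    have hU := ih ((Finset.subset_insert q U).trans hUQ) hd.2
    have hqQ := hUQ (Finset.mem_insert_self q U)
    have hsub : U ∪ P ⊆ Q := Finset.union_subset ((Finset.subset_insert q U).trans hUQ) hPQ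
    rw [Finset.insert_union, bernoulliExpect_insert a (by simp [hq, hd.1])]
    have h3 : bernoulliExpect a (U ∪ P) (fun T => f (insert q T)) ≤ bernoulliExpect a (U ∪ P) f :=
      bernoulliExpect_mono (fun p hp => ha0 p (hsub hp)) (fun p hp => ha1 p (hsub hp))
        fun T _ => hf (Finset.subset_insert q T)
    nlinarith [mul_le_mul_of_nonneg_left h3 (ha0 q hqQ)]

/-! ### Selberg's diagonalisation -/

/-- Selberg's minimisation of the quadratic form `E (∑_{D ⊆ T} Λ(D))²` over `Λ` supported on a
downward closed family `𝒮` with `Λ(∅) = 1`: the value `∏ (1 - a p) / E 1_𝒮` is attained. -/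
theorem exists_selberg_coefficients {a : ℕ → ℝ} {P : Finset ℕ} (ha0 : ∀ p ∈ P, 0 ≤ a p)
    (ha1 : ∀ p ∈ P, a p < 1) {𝒮 : Finset (Finset ℕ)} (h𝒮 : 𝒮 ⊆ P.powerset) (hem : ∅ ∈ 𝒮)
    (hdown : ∀ e ∈ 𝒮, ∀ D ⊆ e, D ∈ 𝒮) :
    ∃ Λ : Finset ℕ → ℝ, Λ ∅ = 1 ∧
      bernoulliExpect a P (fun T => (∑ D ∈ 𝒮, Λ D * if D ⊆ T then 1 else 0) ^ 2) =
        (∏ p ∈ P, (1 - a p)) / ∑ T ∈ 𝒮, bernoulliWeight a P T := by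
  set h : ℕ → ℝ := fun p => a p / (1 - a p) with hh
  have hsub : ∀ e ∈ 𝒮, e ⊆ P := fun e he => Finset.mem_powerset.1 (h𝒮 he)
  have h1a : ∀ p ∈ P, 0 < 1 - a p := fun p hp => sub_pos.2 (ha1 p hp)
  have hh0 : ∀ p ∈ P, 0 ≤ h p := fun p hp => div_nonneg (ha0 p hp) (h1a p hp).le
  set G : ℝ := ∑ e ∈ 𝒮, ∏ p ∈ e, h p with hG
  have hG0 : 0 < G := by
    refine lt_of_lt_of_le one_pos ?_
    have := Finset.single_le_sum (f := fun e => ∏ p ∈ e, h p)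
      (fun e he => Finset.prod_nonneg fun p hp => hh0 p (hsub e he hp)) hem
    simpa using this
  set W : ℝ := ∏ p ∈ P, (1 - a p) with hW
  have hW0 : 0 < W := Finset.prod_pos h1a
  have hweight : ∑ T ∈ 𝒮, bernoulliWeight a P T = W * G := by
    rw [hG, Finset.mul_sum]
    refine Finset.sum_congr rfl fun T hT => ?_
    have hT0 : ∏ p ∈ T, (1 - a p) ≠ 0 :=
      (Finset.prod_pos fun p hp => h1a p (hsub T hT hp)).ne'
    rw [hW, ← Finset.prod_sdiff (hsub T hT), hh, Finset.prod_div_distrib, bernoulliWeight]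
    field_simp
  -- Each local factor has mean `(1 - a)h - a = 0` and second moment `a + (1 - a)h² = h`, so the `χ
  -- e` are orthogonal with squared norm `∏ h`. Expanding the product writes `χ e` through the
  -- indicators of `D ⊆ T` with `D ⊆ e`.
  set χ : Finset ℕ → Finset ℕ → ℝ := fun e T => ∏ p ∈ e, if p ∈ T then -1 else h p with hχ
  have hχsum : ∀ e T : Finset ℕ, χ e T = ∑ D ∈ e.powerset,
      ((∏ p ∈ D, -(1 + h p)) * ∏ p ∈ e \ D, h p) * if D ⊆ T then 1 else 0 := by
    intro e T
    have h2 : χ e T = ∏ p ∈ e, ((if p ∈ T then -(1 + h p) else 0) + h p) :=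
      Finset.prod_congr rfl fun p _ => by split_ifs <;> ring
    rw [h2, Finset.prod_add]
    refine Finset.sum_congr rfl fun D _ => ?_
    rw [mul_right_comm]
    congr 1
    by_cases hDT : D ⊆ T
    · rw [if_pos hDT, mul_one]
      exact Finset.prod_congr rfl fun p hp => if_pos (hDT hp)
    · rw [if_neg hDT, mul_zero]
      obtain ⟨p, hpD, hpT⟩ := Finset.not_subset.1 hDT
      exact Finset.prod_eq_zero hpD (if_neg hpT)
  have horth : ∀ e ∈ 𝒮, ∀ e' ∈ 𝒮, bernoulliExpect a P (fun T => χ e T * χ e' T) =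
      if e = e' then ∏ p ∈ e, h p else 0 := by
    intro e he e' he'
    have hprod : ∀ T, χ e T * χ e' T = ∏ p ∈ P, if p ∈ T then
        (if p ∈ e then -1 else 1) * (if p ∈ e' then -1 else 1) else
        (if p ∈ e then h p else 1) * (if p ∈ e' then h p else 1) := by
      intro T
      have hext : ∀ e ∈ 𝒮, χ e T =
          ∏ p ∈ P, if p ∈ e then (if p ∈ T then -1 else h p) else 1 := by
        intro e he
        rw [Finset.prod_ite_mem, Finset.inter_eq_right.2 (hsub e he)]
      rw [hext e he, hext e' he', ← Finset.prod_mul_distrib]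
      refine Finset.prod_congr rfl fun p _ => ?_
      split_ifs <;> ring
    simp only [hprod]
    rw [bernoulliExpect_prod_ite a
      (fun p => (if p ∈ e then -1 else 1) * (if p ∈ e' then -1 else 1))
      (fun p => (if p ∈ e then h p else 1) * (if p ∈ e' then h p else 1))]
    split_ifs with hee
    · subst hee
      rw [← Finset.inter_eq_right.2 (hsub e he), ← Finset.prod_ite_mem]
      refine Finset.prod_congr rfl fun p hp => ?_
      have := (h1a p hp).ne'
      simp only [Finset.mem_inter, hp, true_and]
      split_ifs
      · simp only [hh]
        field_simp
        ring
      · ring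
    · obtain ⟨p, hp⟩ : ∃ p, ¬(p ∈ e ↔ p ∈ e') := by
        by_contra hcon
        push Not at hcon
        exact hee (Finset.ext hcon)
      have hpP : p ∈ P := by
        by_cases h1 : p ∈ e
        · exact hsub e he h1
        · refine hsub e' he' ?_
          by_contra h2
          exact hp (by simp [h1, h2])
      refine Finset.prod_eq_zero hpP ?_
      have h3 : (1 - a p) * h p = a p := mul_div_cancel₀ _ (h1a p hpP).ne'
      by_cases h1 : p ∈ e
      · have h2 : p ∉ e' := fun h2 => hp (by simp [h1, h2])
        simp only [h1, h2, if_true, if_false]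
        linarith
      · have h2 : p ∈ e' := by
          by_contra h2
          exact hp (by simp [h1, h2])
        simp only [h1, h2, if_true, if_false]
        linarith
  -- `Λ` collects the coefficients of `(1/G) ∑ χ e`. At `∅` they sum to `G/G = 1`, and by
  -- orthogonality the second moment is `G/G² = 1/G`.
  refine ⟨fun D => (∑ e ∈ 𝒮, if D ⊆ e then
    (∏ p ∈ D, -(1 + h p)) * ∏ p ∈ e \ D, h p else 0) / G, ?_, ?_⟩
  · simp [← hG, hG0.ne']
  · have hθ : ∀ T, ∑ D ∈ 𝒮, (∑ e ∈ 𝒮, if D ⊆ e then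
        (∏ p ∈ D, -(1 + h p)) * ∏ p ∈ e \ D, h p else 0) / G * (if D ⊆ T then 1 else 0) =
        (∑ e ∈ 𝒮, χ e T) / G := by
      intro T
      rw [Finset.sum_div]
      simp only [Finset.sum_div, Finset.sum_mul]
      rw [Finset.sum_comm]
      refine Finset.sum_congr rfl fun e he => ?_
      rw [hχsum e T, Finset.sum_div]
      symm
      -- Downward closure is used here: every `D` in the expansion of `χ e` is an admissible index.
      refine Finset.sum_subset_zero_on_sdiff (fun D hD => hdown e he D (Finset.mem_powerset.1 hD))
        (fun D hD => ?_) fun D hD => ?_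
      · rw [if_neg fun hDe => (Finset.mem_sdiff.1 hD).2 (Finset.mem_powerset.2 hDe), zero_div,
          zero_mul]
      · rw [if_pos (Finset.mem_powerset.1 hD)]
        ring
    simp only [hθ]
    have hE : bernoulliExpect a P (fun T => ((∑ e ∈ 𝒮, χ e T) / G) ^ 2) =
        (∑ e ∈ 𝒮, ∑ e' ∈ 𝒮, bernoulliExpect a P fun T => χ e T * χ e' T) / G ^ 2 := by
      simp only [bernoulliExpect]
      have : ∀ e ∈ 𝒮, ∑ e' ∈ 𝒮, ∑ T ∈ P.powerset, bernoulliWeight a P T * (χ e T * χ e' T) =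
          ∑ T ∈ P.powerset, ∑ e' ∈ 𝒮, bernoulliWeight a P T * (χ e T * χ e' T) :=
        fun e _ => Finset.sum_comm
      rw [Finset.sum_congr rfl this, Finset.sum_comm, Finset.sum_div]
      refine Finset.sum_congr rfl fun T _ => ?_
      rw [div_pow, sq (∑ e ∈ 𝒮, χ e T), Finset.sum_mul_sum, ← mul_div_assoc, Finset.mul_sum]
      congr 1
      exact Finset.sum_congr rfl fun e _ => Finset.mul_sum _ _ _
    rw [hE, hweight]
    have hdiag : ∑ e ∈ 𝒮, ∑ e' ∈ 𝒮, bernoulliExpect a P (fun T => χ e T * χ e' T) = G := by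
      rw [hG]
      refine Finset.sum_congr rfl fun e he => ?_
      rw [Finset.sum_congr rfl fun e' he' => horth e he e' he', Finset.sum_ite_eq, if_pos he]
    rw [hdiag]
    field_simp

/-! ### From squarefree integers to sets of primes -/

theorem mem_sievePrimes {W₀ : ℕ} {z : ℝ} (hz : 0 ≤ z) {p : ℕ} :
    p ∈ sievePrimes W₀ z ↔ p.Prime ∧ (p : ℝ) ≤ z ∧ ¬ p ∣ W₀ := by
  rw [sievePrimes, Finset.mem_filter, Finset.mem_Icc, Nat.le_floor_iff hz]
  constructor
  · rintro ⟨⟨_, h⟩, hp, hW⟩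
    exact ⟨hp, h, hW⟩
  · rintro ⟨hp, h, hW⟩
    exact ⟨⟨hp.one_le, h⟩, hp, hW⟩

theorem mem_selbergSupport {W₀ : ℕ} {z R : ℝ} (hz : 0 ≤ z) (hR : 0 ≤ R) {d : ℕ} :
    d ∈ selbergSupport W₀ z R ↔
      Squarefree d ∧ d.primeFactors ⊆ sievePrimes W₀ z ∧ (d : ℝ) ≤ R := by
  rw [selbergSupport, Finset.mem_filter, Finset.mem_Icc, Nat.le_floor_iff hR]
  constructor
  · rintro ⟨⟨_, h⟩, hd, hp, hc⟩
    refine ⟨hd, fun p hpd => (mem_sievePrimes hz).2 ⟨Nat.prime_of_mem_primeFactors hpd,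
      hp p hpd, fun hpW => ?_⟩, h⟩
    exact Nat.not_coprime_of_dvd_of_dvd (Nat.prime_of_mem_primeFactors hpd).one_lt
      (Nat.dvd_of_mem_primeFactors hpd) hpW hc
  · rintro ⟨hd, hp, h⟩
    refine ⟨⟨Nat.one_le_iff_ne_zero.2 hd.ne_zero, h⟩, hd,
      fun p hpd => ((mem_sievePrimes hz).1 (hp hpd)).2.1, ?_⟩
    refine Nat.coprime_of_dvd fun p hpp hpd hpW => ?_
    exact ((mem_sievePrimes hz).1 (hp (Nat.mem_primeFactors.2 ⟨hpp, hpd, hd.ne_zero⟩))).2.2 hpW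

theorem squarefree_prod_primes {T : Finset ℕ} (hT : ∀ p ∈ T, p.Prime) :
    Squarefree (∏ p ∈ T, p) := by
  refine Finset.squarefree_prod_of_pairwise_isCoprime (fun p hp q hq hpq => ?_)
    fun p hp => (hT p hp).squarefree
  exact Nat.coprime_iff_isRelPrime.1 ((Nat.coprime_primes (hT p hp) (hT q hq)).2 hpq)

/-- The subsets of `P` with product at most `R`. -/
def smallProductSubsets (P : Finset ℕ) (R : ℝ) : Finset (Finset ℕ) :=
  P.powerset.filter fun T => ((∏ p ∈ T, p : ℕ) : ℝ) ≤ R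

theorem sum_selbergSupport_eq {W₀ : ℕ} {z R : ℝ} (hz : 0 ≤ z) (hR : 0 ≤ R) (f : Finset ℕ → ℝ) :
    ∑ d ∈ selbergSupport W₀ z R, f d.primeFactors =
      ∑ D ∈ smallProductSubsets (sievePrimes W₀ z) R, f D := by
  have hprime : ∀ D ⊆ sievePrimes W₀ z, ∀ p ∈ D, p.Prime := fun D hD p hp =>
    ((mem_sievePrimes hz).1 (hD hp)).1
  refine Finset.sum_nbij' (fun d => d.primeFactors) (fun D => ∏ p ∈ D, p) ?_ ?_ ?_ ?_
    fun _ _ => rfl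
  · intro d hd
    obtain ⟨h1, h2, h3⟩ := (mem_selbergSupport hz hR).1 hd
    refine Finset.mem_filter.2 ⟨Finset.mem_powerset.2 h2, ?_⟩
    rwa [Nat.prod_primeFactors_of_squarefree h1]
  · intro D hD
    obtain ⟨h1, h2⟩ := Finset.mem_filter.1 hD
    rw [Finset.mem_powerset] at h1
    refine (mem_selbergSupport hz hR).2 ⟨squarefree_prod_primes (hprime D h1), ?_, h2⟩
    rwa [Nat.primeFactors_prod (hprime D h1)]
  · intro d hd
    exact Nat.prod_primeFactors_of_squarefree ((mem_selbergSupport hz hR).1 hd).1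
  · intro D hD
    exact Nat.primeFactors_prod (hprime D (Finset.mem_powerset.1 (Finset.mem_filter.1 hD).1))

namespace ObstructionPattern

/-- The proportion `ω(p) / (p - 1)` of forbidden reduced residue classes modulo `p`. -/
def prob (Ω : ObstructionPattern) (p : ℕ) : ℝ := ((Ω p).card : ℝ) / ((p : ℝ) - 1)

theorem prob_nonneg (Ω : ObstructionPattern) {p : ℕ} (hp : p.Prime) : 0 ≤ Ω.prob p := by
  have : (1 : ℝ) ≤ p := by exact_mod_cast hp.one_le
  exact div_nonneg (Nat.cast_nonneg _) (by linarith)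

theorem card_le_sub_one (Ω : ObstructionPattern) {p : ℕ} (hp : p.Prime) : (Ω p).card ≤ p - 1 := by
  have : Fact p.Prime := ⟨hp⟩
  have := Finset.card_le_univ (Ω p)
  rwa [ZMod.card_units_eq_totient, Nat.totient_prime hp] at this

theorem prob_le_one (Ω : ObstructionPattern) {p : ℕ} (hp : p.Prime) : Ω.prob p ≤ 1 := by
  have h1 : (1 : ℝ) < p := by exact_mod_cast hp.one_lt
  refine (div_le_one (by linarith)).2 ?_
  have h2 : ((Ω p).card : ℝ) ≤ ((p - 1 : ℕ) : ℝ) := by exact_mod_cast Ω.card_le_sub_one hp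
  rwa [Nat.cast_sub hp.one_le, Nat.cast_one] at h2

theorem omega_prime (Ω : ObstructionPattern) {p : ℕ} (hp : p.Prime) : Ω.omega p = (Ω p).card := by
  rw [omega, hp.primeFactors, Finset.prod_singleton]

theorem weakLoc_eq (Ω : ObstructionPattern) (W₀ : ℕ) (z : ℝ) :
    Ω.weakLoc W₀ z = ∏ p ∈ sievePrimes W₀ z, (1 - Ω.prob p) := by
  refine Finset.prod_congr rfl fun p hp => ?_
  rw [Ω.omega_prime (Finset.mem_filter.1 hp).2.1, prob]

/-- The Selberg form as the second moment of `∑_{d ∣ ∏ T} λ_d` over the random set `T`. -/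
theorem selbergForm_eq (Ω : ObstructionPattern) {W₀ : ℕ} {z R : ℝ} (hz : 0 ≤ z) (hR : 0 ≤ R)
    (lam : ℕ → ℝ) :
    Ω.selbergForm W₀ z R lam = bernoulliExpect Ω.prob (sievePrimes W₀ z) fun T =>
      (∑ d ∈ selbergSupport W₀ z R, lam d * if d.primeFactors ⊆ T then 1 else 0) ^ 2 := by
  set S := selbergSupport W₀ z R
  set P := sievePrimes W₀ z
  have hS : ∀ d ∈ S, Squarefree d ∧ d.primeFactors ⊆ P := fun d hd =>
    ⟨((mem_selbergSupport hz hR).1 hd).1, ((mem_selbergSupport hz hR).1 hd).2.1⟩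
  have hterm : ∀ d₁ ∈ S, ∀ d₂ ∈ S, lam d₁ * lam d₂ * Ω.density (Nat.lcm d₁ d₂) =
      ∑ T ∈ P.powerset, bernoulliWeight Ω.prob P T *
        ((lam d₁ * if d₁.primeFactors ⊆ T then 1 else 0) *
          (lam d₂ * if d₂.primeFactors ⊆ T then 1 else 0)) := by
    intro d₁ h₁ d₂ h₂
    obtain ⟨hs₁, hp₁⟩ := hS d₁ h₁
    obtain ⟨hs₂, hp₂⟩ := hS d₂ h₂
    have hs : Squarefree (Nat.lcm d₁ d₂) := by
      rw [Nat.squarefree_iff_factorization_le_one (Nat.lcm_ne_zero hs₁.ne_zero hs₂.ne_zero)]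
      intro p
      rw [Nat.factorization_lcm hs₁.ne_zero hs₂.ne_zero]
      exact sup_le (hs₁.natFactorization_le_one p) (hs₂.natFactorization_le_one p)
    have hu : (Nat.lcm d₁ d₂).primeFactors = d₁.primeFactors ∪ d₂.primeFactors := by
      rw [← Nat.support_factorization, Nat.factorization_lcm hs₁.ne_zero hs₂.ne_zero,
        Finsupp.support_sup, Nat.support_factorization, Nat.support_factorization]
    have hE := bernoulliExpect_prod_ite Ω.prob (fun _ => 1)
      (fun p => if p ∈ d₁.primeFactors ∪ d₂.primeFactors then 0 else 1) P
    have hR : ∏ p ∈ P, (Ω.prob p * 1 + (1 - Ω.prob p) *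
        if p ∈ d₁.primeFactors ∪ d₂.primeFactors then 0 else 1) =
        ∏ p ∈ d₁.primeFactors ∪ d₂.primeFactors, Ω.prob p := by
      rw [← Finset.inter_eq_right.2 (Finset.union_subset hp₁ hp₂), ← Finset.prod_ite_mem]
      refine Finset.prod_congr rfl fun p hp => ?_
      simp only [Finset.mem_inter, hp, true_and]
      split_ifs <;> ring
    rw [Ω.density_eq hs, hu]
    change lam d₁ * lam d₂ * (∏ p ∈ d₁.primeFactors ∪ d₂.primeFactors, Ω.prob p) = _
    rw [← hR, ← hE, bernoulliExpect, Finset.mul_sum]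
    refine Finset.sum_congr rfl fun T _ => ?_
    have hind : (∏ p ∈ P, if p ∈ T then (1 : ℝ) else
        if p ∈ d₁.primeFactors ∪ d₂.primeFactors then 0 else 1) =
        (if d₁.primeFactors ⊆ T then 1 else 0) * (if d₂.primeFactors ⊆ T then 1 else 0) := by
      rw [ite_zero_mul_ite_zero, mul_one]
      split_ifs with h
      · refine Finset.prod_eq_one fun p _ => ?_
        split_ifs with h3 h4
        · rfl
        · exact absurd (Finset.union_subset h.1 h.2 h4) h3
        · rfl
      · rw [← Finset.union_subset_iff] at h
        obtain ⟨p, hpU, hpT⟩ := Finset.not_subset.1 h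
        exact Finset.prod_eq_zero (Finset.union_subset hp₁ hp₂ hpU) (by simp only [hpT, hpU,
          if_true, if_false])
    rw [hind]
    ring
  rw [selbergForm, bernoulliExpect]
  calc _ = ∑ d₁ ∈ S, ∑ d₂ ∈ S, ∑ T ∈ P.powerset, bernoulliWeight Ω.prob P T *
          ((lam d₁ * if d₁.primeFactors ⊆ T then 1 else 0) *
            (lam d₂ * if d₂.primeFactors ⊆ T then 1 else 0)) :=
        Finset.sum_congr rfl fun d₁ h₁ => Finset.sum_congr rfl fun d₂ h₂ => hterm d₁ h₁ d₂ h₂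
    _ = ∑ d₁ ∈ S, ∑ T ∈ P.powerset, ∑ d₂ ∈ S, bernoulliWeight Ω.prob P T *
          ((lam d₁ * if d₁.primeFactors ⊆ T then 1 else 0) *
            (lam d₂ * if d₂.primeFactors ⊆ T then 1 else 0)) :=
        Finset.sum_congr rfl fun _ _ => Finset.sum_comm
    _ = _ := by
        rw [Finset.sum_comm]
        refine Finset.sum_congr rfl fun T _ => ?_
        rw [sq, Finset.sum_mul_sum, Finset.mul_sum]
        exact Finset.sum_congr rfl fun _ _ => (Finset.mul_sum _ _ _).symm

theorem weakSel_le_selbergForm (Ω : ObstructionPattern) (W₀ : ℕ) (z R : ℝ) {lam : ℕ → ℝ}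
    (h1 : lam 1 = 1) (h0 : ∀ d, d ∉ selbergSupport W₀ z R → lam d = 0) :
    Ω.weakSel W₀ z R ≤ Ω.selbergForm W₀ z R lam :=
  csInf_le (Ω.selbergValues_bddBelow W₀ z R) ⟨lam, h1, h0, rfl⟩

theorem one_mem_selbergSupport {W₀ : ℕ} {z R : ℝ} (hz : 0 ≤ z) (hR : 1 ≤ R) :
    1 ∈ selbergSupport W₀ z R :=
  (mem_selbergSupport hz (zero_le_one.trans hR)).2 ⟨squarefree_one, by simp, by simpa using hR⟩

theorem weakSel_le_one (Ω : ObstructionPattern) {W₀ : ℕ} {z R : ℝ} (hz : 0 ≤ z) (hR : 1 ≤ R) :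
    Ω.weakSel W₀ z R ≤ 1 := by
  have h1 := one_mem_selbergSupport (W₀ := W₀) hz hR
  refine (Ω.weakSel_le_selbergForm W₀ z R (lam := fun d => if d = 1 then 1 else 0) (if_pos rfl)
    fun d hd => if_neg ?_).trans (le_of_eq ?_)
  · rintro rfl
    exact hd h1
  · rw [selbergForm, Finset.sum_eq_single_of_mem 1 h1, Finset.sum_eq_single_of_mem 1 h1]
    · simp [density, omega]
    · intro d _ hd
      simp [hd]
    · intro d _ hd
      simp [hd]

/-- If all classes are forbidden for some sieving prime, then the Selberg form represents zero. -/
theorem weakSel_nonpos (Ω : ObstructionPattern) {W₀ : ℕ} {z R : ℝ} (hz : 1 ≤ z) (hzR : z ≤ R)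
    {q : ℕ} (hq : q ∈ sievePrimes W₀ z) (hq1 : Ω.prob q = 1) : Ω.weakSel W₀ z R ≤ 0 := by
  have hz0 : 0 ≤ z := zero_le_one.trans hz
  have hR0 : 0 ≤ R := hz0.trans hzR
  obtain ⟨hqp, hqz, -⟩ := (mem_sievePrimes hz0).1 hq
  have h1 := one_mem_selbergSupport (W₀ := W₀) hz0 (hz.trans hzR)
  have h2 : q ∈ selbergSupport W₀ z R := by
    refine (mem_selbergSupport hz0 hR0).2 ⟨hqp.squarefree, ?_, hqz.trans hzR⟩
    rwa [hqp.primeFactors, Finset.singleton_subset_iff]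
  refine (Ω.weakSel_le_selbergForm W₀ z R
    -- With `λ_1 = 1`, `λ_q = -1` the inner sum vanishes when `q ∈ T`, and sets `T` without `q` have
    -- weight 0. Admissibility needs `q ≤ z ≤ R`.
    (lam := fun d => if d = 1 then 1 else if d = q then -1 else 0) (if_pos rfl)
    fun d hd => ?_).trans (le_of_eq ?_)
  · have hd1 : d ≠ 1 := by
      rintro rfl
      exact hd h1
    have hdq : d ≠ q := by
      rintro rfl
      exact hd h2
    simp [hd1, hdq]
  · rw [Ω.selbergForm_eq hz0 hR0, bernoulliExpect]
    refine Finset.sum_eq_zero fun T _ => ?_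
    by_cases hqT : q ∈ T
    · rw [Finset.sum_eq_add_of_mem 1 q h1 h2 hqp.one_lt.ne]
      · simp [hqp.primeFactors, hqT, hqp.one_lt.ne']
      · intro d _ hd
        simp [hd.1, hd.2]
    · rw [bernoulliWeight, Finset.prod_eq_zero (i := q) (s := sievePrimes W₀ z \ T)
        (Finset.mem_sdiff.2 ⟨hq, hqT⟩) (by rw [hq1, sub_self])]
      simp

theorem weakSel_le_weakLoc_div (Ω : ObstructionPattern) {W₀ : ℕ} {z R : ℝ} (hz : 0 ≤ z)
    (hR : 1 ≤ R) (hlt : ∀ p ∈ sievePrimes W₀ z, Ω.prob p < 1) :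
    Ω.weakSel W₀ z R ≤ Ω.weakLoc W₀ z /
      ∑ T ∈ smallProductSubsets (sievePrimes W₀ z) R,
        bernoulliWeight Ω.prob (sievePrimes W₀ z) T := by
  have hR0 : 0 ≤ R := zero_le_one.trans hR
  have hprime : ∀ p ∈ sievePrimes W₀ z, p.Prime := fun p hp => ((mem_sievePrimes hz).1 hp).1
  obtain ⟨Λ, hΛ1, hΛ⟩ := exists_selberg_coefficients
    (fun p hp => Ω.prob_nonneg (hprime p hp)) hlt
    (𝒮 := smallProductSubsets (sievePrimes W₀ z) R) (Finset.filter_subset _ _)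
    (by simp [smallProductSubsets, hR])
    (by
      intro e he D hDe
      obtain ⟨h1, h2⟩ := Finset.mem_filter.1 he
      rw [Finset.mem_powerset] at h1
      refine Finset.mem_filter.2 ⟨Finset.mem_powerset.2 (hDe.trans h1), le_trans ?_ h2⟩
      exact_mod_cast Finset.prod_le_prod_of_subset_of_one_le' hDe
        fun p hp _ => (hprime p (h1 hp)).one_le)
  rw [weakLoc_eq, ← hΛ]
  have h1 := one_mem_selbergSupport (W₀ := W₀) hz hR
  refine (Ω.weakSel_le_selbergForm W₀ z R (lam := fun d =>
    if d ∈ selbergSupport W₀ z R then Λ d.primeFactors else 0) (by simp [h1, hΛ1])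
    fun d hd => if_neg hd).trans (le_of_eq ?_)
  rw [Ω.selbergForm_eq hz hR0]
  congr 1
  ext T
  rw [← sum_selbergSupport_eq hz hR0 fun D => Λ D * if D ⊆ T then 1 else 0]
  congr 1
  exact Finset.sum_congr rfl fun d hd => by rw [if_pos hd]

end ObstructionPattern

/-! ### Limiting distribution of the extremal random product -/

/-- The random variable `(∏ T) ^ (-1 / log z)`. -/
def normalizedProd (z : ℝ) (T : Finset ℕ) : ℝ := ∏ p ∈ T, (p : ℝ) ^ (-(1 / Real.log z))

/-- Independence factors the moment over primes. Exponents start at 1 because the transform was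
identified only for `b > 0`; hence the test functions below all carry a factor `x`. -/
theorem tendsto_bernoulliExpect_normalizedProd_pow {κ : ℝ} (hκ : 0 < κ) (n : ℕ) :
    Tendsto (fun z : ℝ => bernoulliExpect (extremalProb κ) (Nat.primesLE ⌊z⌋₊)
      fun T => normalizedProd z T ^ (n + 1)) atTop (𝓝 (selbergLaplace κ (n + 1))) := by
  have hn : (0 : ℝ) < n + 1 := by positivity
  rw [selbergLaplace_eq_exp hκ hn]
  refine (tendsto_prod_one_sub_extremalProb hκ.le hn.le).congr fun z => ?_
  rw [← bernoulliExpect_prod (extremalProb κ) (fun p => (p : ℝ) ^ (-(((n : ℝ) + 1) / Real.log z)))]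
  congr 1
  ext T
  rw [normalizedProd, ← Finset.prod_pow]
  refine Finset.prod_congr rfl fun p _ => ?_
  rw [← Real.rpow_mul_natCast p.cast_nonneg]
  congr 1
  push_cast
  ring

theorem exp_neg_mul_eval_eq_sum (q : Polynomial ℝ) (κ y : ℝ) :
    Real.exp (-y) * q.eval (Real.exp (-y)) * selbergDensity κ y =
      ∑ i ∈ Finset.range (q.natDegree + 1),
        q.coeff i * (Real.exp (-(((i : ℝ) + 1) * y)) * selbergDensity κ y) := by
  rw [Polynomial.eval_eq_sum_range, Finset.mul_sum, Finset.sum_mul]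
  refine Finset.sum_congr rfl fun i _ => ?_
  have : Real.exp (-(((i : ℝ) + 1) * y)) = Real.exp (-y) * Real.exp (-y) ^ i := by
    rw [← Real.exp_nat_mul, ← Real.exp_add]
    congr 1
    ring
  rw [this]
  ring

theorem integrableOn_exp_mul_eval {κ : ℝ} (hκ : 0 < κ) (q : Polynomial ℝ) :
    MeasureTheory.IntegrableOn
      (fun y => Real.exp (-y) * q.eval (Real.exp (-y)) * selbergDensity κ y) (Set.Ioi 0) := by
  simp only [exp_neg_mul_eval_eq_sum]
  exact MeasureTheory.integrable_finsetSum _ fun i _ =>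
    (integrableOn_exp_mul_selbergDensity hκ (by positivity)).const_mul _

theorem tendsto_bernoulliExpect_polynomial {κ : ℝ} (hκ : 0 < κ) (q : Polynomial ℝ) :
    Tendsto (fun z : ℝ => bernoulliExpect (extremalProb κ) (Nat.primesLE ⌊z⌋₊)
      fun T => normalizedProd z T * q.eval (normalizedProd z T)) atTop
      (𝓝 (∫ y in Set.Ioi (0 : ℝ),
        Real.exp (-y) * q.eval (Real.exp (-y)) * selbergDensity κ y)) := by
  simp only [exp_neg_mul_eval_eq_sum]
  rw [MeasureTheory.integral_finsetSum _ fun i _ =>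
    (integrableOn_exp_mul_selbergDensity hκ (by positivity)).const_mul _]
  have h : Tendsto (fun z : ℝ => ∑ i ∈ Finset.range (q.natDegree + 1), q.coeff i *
      bernoulliExpect (extremalProb κ) (Nat.primesLE ⌊z⌋₊) fun T => normalizedProd z T ^ (i + 1))
      atTop (𝓝 (∑ i ∈ Finset.range (q.natDegree + 1), q.coeff i * selbergLaplace κ (i + 1))) :=
    tendsto_finsetSum _ fun i _ =>
      (tendsto_bernoulliExpect_normalizedProd_pow hκ i).const_mul _
  simp only [MeasureTheory.integral_const_mul]
  refine h.congr fun z => ?_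
  simp only [bernoulliExpect, Polynomial.eval_eq_sum_range, Finset.mul_sum]
  rw [Finset.sum_comm]
  refine Finset.sum_congr rfl fun T _ => Finset.sum_congr rfl fun i _ => ?_
  ring

/-- The density may blow up at 0 when `κ < 1`; it is integrable as the nonnegative derivative of a
continuous function. -/
theorem integral_selbergDensity {κ r : ℝ} (hκ : 0 < κ) (hr : 0 < r) :
    MeasureTheory.IntegrableOn (selbergDensity κ) (Set.Ioc 0 r) ∧
      ∫ y in Set.Ioc 0 r, selbergDensity κ y = selbergCdf κ r := by
  have hc : ContinuousOn (selbergCdf κ) (Set.Icc 0 r) := (continuous_selbergCdf hκ).continuousOn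
  have hi : IntervalIntegrable (selbergDensity κ) MeasureTheory.volume 0 r := by
    refine intervalIntegral.intervalIntegrable_deriv_of_nonneg (g := selbergCdf κ) ?_ ?_ ?_
    · rwa [Set.uIcc_of_le hr.le]
    · intro x hx
      rw [min_eq_left hr.le] at hx
      exact hasDerivAt_selbergCdf hκ hx.1
    · intro x hx
      rw [min_eq_left hr.le] at hx
      exact selbergDensity_nonneg hκ hx.1
  refine ⟨(intervalIntegrable_iff_integrableOn_Ioc_of_le hr.le).1 hi, ?_⟩
  rw [← intervalIntegral.integral_of_le hr.le,
    intervalIntegral.integral_eq_sub_of_hasDerivAt_of_le hr.le hc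
      (fun x hx => hasDerivAt_selbergCdf hκ hx.1) hi, selbergCdf_of_nonpos κ le_rfl, sub_zero]

/-- The indicator function of `∏ T ≤ R`, for sets `T` of positive integers. -/
def smallProductIndicator (R : ℝ) (T : Finset ℕ) : ℝ :=
  if ((∏ p ∈ T, max p 1 : ℕ) : ℝ) ≤ R then 1 else 0

/-- The `max p 1` in the product makes it monotone over all finite sets, even those containing 0, as
the comparison lemmas require. -/
theorem antitone_smallProductIndicator (R : ℝ) : Antitone (smallProductIndicator R) := by
  intro S T hST
  have h : ((∏ p ∈ S, max p 1 : ℕ) : ℝ) ≤ ((∏ p ∈ T, max p 1 : ℕ) : ℝ) := by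
    exact_mod_cast Finset.prod_le_prod_of_subset_of_one_le' hST fun p _ _ => le_max_right _ _
  rw [smallProductIndicator, smallProductIndicator]
  split_ifs with h1 h2
  · exact le_rfl
  · exact absurd (h.trans h1) h2
  · exact zero_le_one
  · exact le_rfl

theorem prod_max_one_eq {T : Finset ℕ} (hT : ∀ p ∈ T, p.Prime) :
    ∏ p ∈ T, max p 1 = ∏ p ∈ T, p :=
  Finset.prod_congr rfl fun p hp => max_eq_left (hT p hp).one_le

theorem normalizedProd_mem_Ioc {z : ℝ} (hz : 1 < z) {T : Finset ℕ} (hT : ∀ p ∈ T, p.Prime) :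
    normalizedProd z T ∈ Set.Ioc (0 : ℝ) 1 := by
  have hl : 0 < Real.log z := Real.log_pos hz
  have hp : ∀ p ∈ T, (1 : ℝ) ≤ p := fun p h => by exact_mod_cast (hT p h).one_le
  constructor
  · exact Finset.prod_pos fun p h => Real.rpow_pos_of_pos (by linarith [hp p h]) _
  · refine Finset.prod_le_one (fun p h => Real.rpow_nonneg (by linarith [hp p h]) _) fun p h => ?_
    exact Real.rpow_le_one_of_one_le_of_nonpos (hp p h) (neg_nonpos.2 (by positivity))

theorem normalizedProd_lt_exp_neg {z s : ℝ} (hz : 1 < z) {T : Finset ℕ}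
    (h : z ^ s < ((∏ p ∈ T, p : ℕ) : ℝ)) : normalizedProd z T < Real.exp (-s) := by
  have hl : 0 < Real.log z := Real.log_pos hz
  have hz0 : 0 < z := by linarith
  have h1 : normalizedProd z T = ((∏ p ∈ T, p : ℕ) : ℝ) ^ (-(1 / Real.log z)) := by
    rw [normalizedProd, Real.finsetProd_rpow _ _ fun p _ => p.cast_nonneg]
    push_cast
    rfl
  have h2 : (z ^ s) ^ (-(1 / Real.log z)) = Real.exp (-s) := by
    rw [← Real.rpow_mul hz0.le, Real.rpow_def_of_pos hz0]
    congr 1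
    field_simp
  rw [h1, ← h2]
  exact Real.rpow_lt_rpow_of_neg (Real.rpow_pos_of_pos hz0 s) h (neg_neg_of_pos (by positivity))

/-- One-sided Weierstrass approximation: a polynomial multiple of `x` lies below the indicator of `x
≥ e^(-s)` on `[0, 1]`, and its limiting expectation is nearly `selbergCdf κ s`. The loss `ε` splits
into `ε/4` for `r < s`, `ε/2` for the polynomial and `ε/4` for the limit in `z`. -/
theorem eventually_lt_bernoulliExpect_smallProductIndicator {κ s ε : ℝ} (hκ : 0 < κ) (hs : 0 < s)
    (hε : 0 < ε) : ∀ᶠ z : ℝ in atTop, selbergCdf κ s - ε <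
      bernoulliExpect (extremalProb κ) (Nat.primesLE ⌊z⌋₊) (smallProductIndicator (z ^ s)) := by
  obtain ⟨r, hr0, hrs, hr⟩ : ∃ r, 0 < r ∧ r < s ∧ selbergCdf κ s - ε / 4 < selbergCdf κ r := by
    have h1 : ∀ᶠ r in 𝓝[<] s, selbergCdf κ s - ε / 4 < selbergCdf κ r :=
      ((continuous_selbergCdf hκ).continuousAt.eventually
        (lt_mem_nhds (by linarith))).filter_mono nhdsWithin_le_nhds
    have h2 : ∀ᶠ r in 𝓝[<] s, 0 < r := (lt_mem_nhds hs).filter_mono nhdsWithin_le_nhds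
    obtain ⟨r, ⟨h3, h4⟩, h5⟩ := ((h1.and h2).and self_mem_nhdsWithin).exists
    exact ⟨r, h4, h5, h3⟩
  have hexp : Real.exp (-s) < Real.exp (-r) := Real.exp_lt_exp.2 (neg_lt_neg hrs)
  have hes := Real.exp_pos (-s)
  -- A continuous ramp from 0 at `e^(-s)` to 1 at `e^(-r)`. As it vanishes near 0, it can be divided
  -- by `x` to give the continuous function `h`.
  set g : ℝ → ℝ := fun x => max 0 (min 1 ((x - Real.exp (-s)) / (Real.exp (-r) - Real.exp (-s))))
    with hg
  have hg0 : ∀ x, 0 ≤ g x := fun x => le_max_left _ _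
  have hg1 : ∀ x, g x ≤ 1 := fun x => max_le zero_le_one (min_le_left _ _)
  have hgz : ∀ x, x ≤ Real.exp (-s) → g x = 0 := fun x hx => max_eq_left ((min_le_right _ _).trans
    (div_nonpos_of_nonpos_of_nonneg (by linarith) (by linarith)))
  have hgo : ∀ x, Real.exp (-r) ≤ x → g x = 1 := fun x hx => by
    have : 1 ≤ (x - Real.exp (-s)) / (Real.exp (-r) - Real.exp (-s)) :=
      (one_le_div (by linarith)).2 (by linarith)
    simp only [hg, min_eq_left this, max_eq_right zero_le_one]
  have hgc : Continuous g := continuous_const.max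
    (continuous_const.min ((continuous_id.sub continuous_const).div_const _))
  set h : ℝ → ℝ := fun x => g x / max x (Real.exp (-s)) with hh
  have hhc : Continuous h := hgc.div (continuous_id.max continuous_const)
    fun x => (hes.trans_le (le_max_right _ _)).ne'
  have hxh : ∀ x, x * h x = g x := by
    intro x
    rcases le_or_gt x (Real.exp (-s)) with hx | hx
    · simp only [hh, hgz x hx, zero_div, mul_zero]
    · simp only [hh, max_eq_left hx.le]
      exact mul_div_cancel₀ _ (hes.trans hx).ne'
  obtain ⟨q, hq⟩ := exists_polynomial_near_of_continuousOn 0 1 h hhc.continuousOn (ε / 4)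
    (by linarith)
  -- Lowering the approximant by its own error turns it into a minorant of `h`, at distance at most
  -- `ε/2`.
  set q' : Polynomial ℝ := q - Polynomial.C (ε / 4) with hq'
  have hupper : ∀ x, 0 ≤ x → x ≤ 1 → x * q'.eval x ≤ g x := by
    intro x hx0 hx1
    have := (abs_lt.1 (hq x ⟨hx0, hx1⟩)).2
    rw [← hxh]
    refine mul_le_mul_of_nonneg_left ?_ hx0
    simp only [hq', Polynomial.eval_sub, Polynomial.eval_C]
    linarith
  have hlower : ∀ x, 0 ≤ x → x ≤ 1 → g x ≤ x * q'.eval x + ε / 2 * x := by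
    intro x hx0 hx1
    have := (abs_lt.1 (hq x ⟨hx0, hx1⟩)).1
    rw [← hxh, mul_comm (ε / 2), ← mul_add]
    refine mul_le_mul_of_nonneg_left ?_ hx0
    simp only [hq', Polynomial.eval_sub, Polynomial.eval_C]
    linarith
  have hint := integrableOn_exp_mul_eval hκ q'
  have hint1 := integrableOn_exp_mul_selbergDensity hκ one_pos
  have hL1 : selbergLaplace κ 1 ≤ 1 := by
    rw [selbergLaplace_eq_exp hκ one_pos, Real.exp_le_one_iff, neg_nonpos]
    exact mul_nonneg hκ.le (intervalIntegral.integral_nonneg zero_le_one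
      fun t ht => (one_sub_exp_neg_div_mem_Icc ht.1).1)
  have hJ : selbergCdf κ r ≤ (∫ y in Set.Ioi (0 : ℝ),
      Real.exp (-y) * q'.eval (Real.exp (-y)) * selbergDensity κ y) + ε / 2 * selbergLaplace κ 1 := by
    have hle : ∀ y, 0 < y → Set.indicator (Set.Ioc 0 r) (selbergDensity κ) y ≤
        Real.exp (-y) * q'.eval (Real.exp (-y)) * selbergDensity κ y +
          ε / 2 * (Real.exp (-(1 * y)) * selbergDensity κ y) := by
      intro y hy
      have hf := selbergDensity_nonneg hκ hy
      have h1 := mul_le_mul_of_nonneg_right (hlower (Real.exp (-y)) (Real.exp_pos _).le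
        (Real.exp_le_one_iff.2 (neg_nonpos.2 hy.le))) hf
      rw [one_mul]
      refine le_trans ?_ (h1.trans (le_of_eq (by ring)))
      by_cases hyr : y ∈ Set.Ioc 0 r
      · rw [Set.indicator_of_mem hyr, hgo _ (Real.exp_le_exp.2 (neg_le_neg hyr.2)), one_mul]
      · rw [Set.indicator_of_notMem hyr]
        exact mul_nonneg (hg0 _) hf
    obtain ⟨hi, he⟩ := integral_selbergDensity hκ hr0
    rw [selbergLaplace, ← MeasureTheory.integral_const_mul,
      ← MeasureTheory.integral_add hint (hint1.const_mul _), ← he]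
    calc ∫ y in Set.Ioc 0 r, selbergDensity κ y
        = ∫ y in Set.Ioi (0 : ℝ), Set.indicator (Set.Ioc 0 r) (selbergDensity κ) y := by
          rw [MeasureTheory.setIntegral_indicator measurableSet_Ioc,
            Set.inter_eq_right.2 Set.Ioc_subset_Ioi_self]
      _ ≤ _ := by
          refine MeasureTheory.setIntegral_mono_on ?_ (hint.add (hint1.const_mul _))
            measurableSet_Ioi hle
          exact (hi.integrable_indicator measurableSet_Ioc).integrableOn
  have hlim := tendsto_bernoulliExpect_polynomial hκ q'
  filter_upwards [eventually_gt_atTop 1, hlim.eventually (lt_mem_nhds (sub_lt_self _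
    (by linarith : 0 < ε / 4)))] with z hz hzE
  have hmono : bernoulliExpect (extremalProb κ) (Nat.primesLE ⌊z⌋₊)
      (fun T => normalizedProd z T * q'.eval (normalizedProd z T)) ≤
      bernoulliExpect (extremalProb κ) (Nat.primesLE ⌊z⌋₊) (smallProductIndicator (z ^ s)) := by
    refine bernoulliExpect_mono
      (fun p hp => extremalProb_nonneg hκ.le (Nat.prime_of_mem_primesLE hp))
      (fun p _ => extremalProb_le_one κ p) fun T hT => ?_
    have hTp : ∀ p ∈ T, p.Prime := fun p hp => Nat.prime_of_mem_primesLE (hT hp)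
    have hX := normalizedProd_mem_Ioc hz hTp
    refine (hupper _ hX.1.le hX.2).trans ?_
    rw [smallProductIndicator, prod_max_one_eq hTp]
    split_ifs with hle
    · exact hg1 _
    · exact (hgz _ (normalizedProd_lt_exp_neg hz (not_le.1 hle)).le).le
  have h2 : ε / 2 * selbergLaplace κ 1 ≤ ε / 2 := mul_le_of_le_one_right (by linarith) hL1
  linarith

/-! ### Comparison with the extremal pattern and conclusion -/

/-- The probability that the extremal random set of primes up to `z` has product at most `z ^ s`. -/
def extremalSmallProb (κ s z : ℝ) : ℝ :=
  bernoulliExpect (extremalProb κ) (Nat.primesLE ⌊z⌋₊) (smallProductIndicator (z ^ s))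

theorem selbergCdf_zero {s : ℝ} (hs : 0 < s) : selbergCdf 0 s = 1 := by
  rw [selbergCdf_eq 0 hs]
  simp [selbergConst]

theorem extremalSmallProb_zero {s z : ℝ} (hs : 0 ≤ s) (hz : 1 ≤ z) :
    extremalSmallProb 0 s z = 1 := by
  rw [extremalSmallProb, bernoulliExpect, Finset.sum_eq_single_of_mem ∅ (Finset.empty_mem_powerset _)]
  · simp [bernoulliWeight, smallProductIndicator, extremalProb, Real.one_le_rpow hz hs]
  · intro T _ hT
    obtain ⟨p, hp⟩ := Finset.nonempty_iff_ne_empty.2 hT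
    rw [bernoulliWeight, Finset.prod_eq_zero hp (by simp [extremalProb]), zero_mul, zero_mul]

theorem selbergCdf_pos_of_nonneg {κ s : ℝ} (hκ : 0 ≤ κ) (hs : 0 < s) : 0 < selbergCdf κ s := by
  rcases hκ.eq_or_lt with rfl | hκ
  · rw [selbergCdf_zero hs]
    exact one_pos
  · exact selbergCdf_pos hκ hs

theorem eventually_lt_extremalSmallProb {κ s ε : ℝ} (hκ : 0 ≤ κ) (hs : 0 < s) (hε : 0 < ε) :
    ∀ᶠ z : ℝ in atTop, selbergCdf κ s - ε < extremalSmallProb κ s z := by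
  rcases hκ.eq_or_lt with rfl | hκ
  · filter_upwards [eventually_ge_atTop 1] with z hz
    rw [selbergCdf_zero hs, extremalSmallProb_zero hs.le hz]
    linarith
  · exact eventually_lt_bernoulliExpect_smallProductIndicator hκ hs hε

namespace ObstructionPattern

theorem extremalSmallProb_le (Ω : ObstructionPattern) {κ s z : ℝ} {W₀ : ℕ} (hκ : 0 ≤ κ)
    (hz : 0 ≤ z) (hΩ : ∀ p ∈ sievePrimes W₀ z, ((Ω p).card : ℝ) ≤ κ) :
    extremalSmallProb κ s z ≤ ∑ T ∈ smallProductSubsets (sievePrimes W₀ z) (z ^ s),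
      bernoulliWeight Ω.prob (sievePrimes W₀ z) T := by
  have hprime : ∀ p ∈ sievePrimes W₀ z, p.Prime := fun p hp => ((mem_sievePrimes hz).1 hp).1
  have hsub : sievePrimes W₀ z ⊆ Nat.primesLE ⌊z⌋₊ := fun p hp =>
    Nat.mem_primesLE.2 ⟨Nat.le_floor ((mem_sievePrimes hz).1 hp).2.1, hprime p hp⟩
  have hanti := antitone_smallProductIndicator (z ^ s)
  refine (bernoulliExpect_anti_subset hsub
    (fun p hp => extremalProb_nonneg hκ (Nat.prime_of_mem_primesLE hp))
    (fun p _ => extremalProb_le_one κ p) hanti).trans ?_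
  refine (bernoulliExpect_anti_prob (a := Ω.prob) (fun p hp => Ω.prob_nonneg (hprime p hp))
    (fun p hp => le_min (Ω.prob_le_one (hprime p hp)) ?_)
    (fun p _ => extremalProb_le_one κ p) hanti).trans (le_of_eq ?_)
  · have : (1 : ℝ) < p := by exact_mod_cast (hprime p hp).one_lt
    exact div_le_div_of_nonneg_right (hΩ p hp) (by linarith)
  · rw [bernoulliExpect, smallProductSubsets, Finset.sum_filter]
    refine Finset.sum_congr rfl fun T hT => ?_
    rw [smallProductIndicator, prod_max_one_eq fun p hp => hprime p (Finset.mem_powerset.1 hT hp),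
      mul_ite, mul_one, mul_zero]

/-- Integrality: `ω(p) < p - 1` forces `ω(p) ≤ p - 2`, so each factor is at least `1/(p-1) ≥ 1/p`.
The resulting bound depends on `z` alone. -/
theorem one_le_mul_weakLoc (Ω : ObstructionPattern) {W₀ : ℕ} {z : ℝ} (hz : 0 ≤ z)
    (hlt : ∀ p ∈ sievePrimes W₀ z, Ω.prob p < 1) :
    1 ≤ (∏ p ∈ Nat.primesLE ⌊z⌋₊, (p : ℝ)) * Ω.weakLoc W₀ z := by
  have hprime : ∀ p ∈ sievePrimes W₀ z, p.Prime := fun p hp => ((mem_sievePrimes hz).1 hp).1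
  have hsub : sievePrimes W₀ z ⊆ Nat.primesLE ⌊z⌋₊ := fun p hp =>
    Nat.mem_primesLE.2 ⟨Nat.le_floor ((mem_sievePrimes hz).1 hp).2.1, hprime p hp⟩
  have h1 : ∏ p ∈ sievePrimes W₀ z, (p : ℝ) ≤ ∏ p ∈ Nat.primesLE ⌊z⌋₊, (p : ℝ) := by
    rw [← Nat.cast_prod, ← Nat.cast_prod, Nat.cast_le]
    exact Finset.prod_le_prod_of_subset_of_one_le' hsub
      fun p hp _ => (Nat.prime_of_mem_primesLE hp).one_le
  rw [weakLoc_eq]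
  refine le_trans ?_ (mul_le_mul_of_nonneg_right h1
    (Finset.prod_nonneg fun p hp => (sub_pos.2 (hlt p hp)).le))
  rw [← Finset.prod_mul_distrib]
  refine (Finset.prod_const_one (s := sievePrimes W₀ z)).symm.le.trans
    (Finset.prod_le_prod (fun _ _ => zero_le_one) fun p hp => ?_)
  have hp1 : (1 : ℝ) < p := by exact_mod_cast (hprime p hp).one_lt
  have h2 : ((Ω p).card : ℝ) < (p : ℝ) - 1 := (div_lt_one (by linarith)).1 (hlt p hp)
  have h3 : ((Ω p).card : ℝ) + 1 ≤ (p : ℝ) - 1 := by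
    have : ((Ω p).card : ℝ) + 1 < p := by linarith
    have h4 : (Ω p).card + 1 < p := by exact_mod_cast this
    have h5 : (((Ω p).card + 1 + 1 : ℕ) : ℝ) ≤ p := by exact_mod_cast h4
    push_cast at h5
    linarith
  have h4 : 1 - Ω.prob p = ((p : ℝ) - 1 - (Ω p).card) / ((p : ℝ) - 1) := by
    have : (p : ℝ) - 1 ≠ 0 := by linarith
    rw [prob]
    field_simp
  rw [h4, ← mul_div_assoc, le_div_iff₀ (by linarith)]
  nlinarith

end ObstructionPattern

end

theorem mainTheorem10 (κ s : ℝ) (hκ : 0 ≤ κ) (hs : 1 < s) :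
    ∃ η : ℝ → ℝ, Tendsto η atTop (𝓝 0) ∧
      ∀ (z R : ℝ) (W₀ : ℕ) (Ω : ObstructionPattern),
        2 ≤ z → 0 < R → Real.log R / Real.log z = s → 1 ≤ W₀ →
        (∀ p : ℕ, p.Prime → (p : ℝ) ≤ z → ¬ p ∣ W₀ → (Ω.omega p : ℝ) ≤ κ) →
        Ω.weakSel W₀ z R ≤ (upperSieveFunction κ s + η z) * Ω.weakLoc W₀ z := by
  classical
  have hs0 : 0 < s := by linarith
  have hσ : 0 < selbergCdf κ s := selbergCdf_pos_of_nonneg hκ hs0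
  have hF : upperSieveFunction κ s = 1 / selbergCdf κ s := rfl
  -- The extremal probability can vanish for small `z`, since primes `p ≤ κ + 1` are always in the
  -- set; the product of all primes then dominates `1 / Weak_loc`. The `max 0` makes `η ≥ 0`, so a
  -- lower bound for the probability suffices for `η → 0`.
  refine ⟨fun z => if 0 < extremalSmallProb κ s z then
    max 0 (1 / extremalSmallProb κ s z - 1 / selbergCdf κ s)
    else ∏ p ∈ Nat.primesLE ⌊z⌋₊, (p : ℝ), ?_, ?_⟩
  · refine tendsto_order.2 ⟨fun a ha => Eventually.of_forall fun z => ?_, fun ε hε => ?_⟩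
    · refine ha.trans_le ?_
      split_ifs
      · exact le_max_left _ _
      · exact Finset.prod_nonneg fun p _ => p.cast_nonneg
    · have h0 : 0 < 1 / selbergCdf κ s + ε := by positivity
      -- This gap is chosen so that the eventual bound reads `extremalSmallProb > 1 / (1/σ + ε)`,
      -- whose reciprocal is the required estimate.
      have h1 : 0 < selbergCdf κ s - 1 / (1 / selbergCdf κ s + ε) := by
        rw [sub_pos, div_lt_iff₀ h0]
        field_simp
        linarith [mul_pos hσ hε]
      filter_upwards [eventually_lt_extremalSmallProb hκ hs0 h1] with z hz
      rw [sub_sub_cancel] at hz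
      have hA : 0 < extremalSmallProb κ s z := (by positivity : (0 : ℝ) < _).trans hz
      rw [if_pos hA]
      refine max_lt hε ?_
      have := (one_div_lt h0 hA).1 hz
      linarith
  · intro z R W₀ Ω hz hR hlog _ hΩ
    have hz0 : 0 ≤ z := by linarith
    have hlz : 0 < Real.log z := Real.log_pos (by linarith)
    have hRz : R = z ^ s := by
      rw [Real.rpow_def_of_pos (by linarith), ← hlog, mul_div_cancel₀ _ hlz.ne', Real.exp_log hR]
    have hzR : z ≤ R := by
      rw [hRz]
      exact Real.self_le_rpow_of_one_le (by linarith) hs.le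
    have hprime : ∀ p ∈ sievePrimes W₀ z, p.Prime := fun p hp => ((mem_sievePrimes hz0).1 hp).1
    by_cases hlt : ∀ p ∈ sievePrimes W₀ z, Ω.prob p < 1
    · have hloc : 0 ≤ Ω.weakLoc W₀ z := by
        rw [Ω.weakLoc_eq]
        exact Finset.prod_nonneg fun p hp => (sub_pos.2 (hlt p hp)).le
      rw [hF]
      beta_reduce
      split_ifs with hA
      · refine (Ω.weakSel_le_weakLoc_div hz0 (by linarith) hlt).trans ?_
        have h1 := Ω.extremalSmallProb_le (s := s) (W₀ := W₀) hκ hz0 fun p hp => by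
          obtain ⟨h1, h2, h3⟩ := (mem_sievePrimes hz0).1 hp
          rw [← Ω.omega_prime h1]
          exact hΩ p h1 h2 h3
        rw [← hRz] at h1
        refine (div_le_div_of_nonneg_left hloc hA h1).trans ?_
        rw [div_eq_mul_one_div, mul_comm]
        refine mul_le_mul_of_nonneg_right ?_ hloc
        linarith [le_max_right 0 (1 / extremalSmallProb κ s z - 1 / selbergCdf κ s)]
      · refine (Ω.weakSel_le_one hz0 (by linarith)).trans ((Ω.one_le_mul_weakLoc hz0 hlt).trans ?_)
        refine mul_le_mul_of_nonneg_right ?_ hloc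
        have : 0 ≤ 1 / selbergCdf κ s := by positivity
        linarith
    · push Not at hlt
      obtain ⟨q, hq, hq1⟩ := hlt
      have hq1' : Ω.prob q = 1 := le_antisymm (Ω.prob_le_one (hprime q hq)) hq1
      have h0 : Ω.weakLoc W₀ z = 0 := by
        rw [Ω.weakLoc_eq]
        exact Finset.prod_eq_zero hq (by rw [hq1', sub_self])
      rw [h0, mul_zero]
      exact Ω.weakSel_nonpos (by linarith) hzR hq hq1'
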